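/- Let $\mathbf A=\mathbb R\cdot 1\oplus\mathcal A$ be a Weil algebra, that is, a finite-dimensional commutative, associative, unital real algebra in which $\mathcal A$ is a maximal ideal with $\mathcal A^{k+1}=0$ for some $k\ge 1$, and let $\alpha_1=1,\alpha_2,\dots,\alpha_l$ be a basis of $\mathbf A$ with $\alpha_2,\dots,\alpha_l\in\mathcal A$. Let $M$ be a smooth (Hausdorff, second countable) manifold of dimension $m\geq 1$ with nonempty boundary $\partial M$. For $x\in M$ let $M^{\mathbf A}_x$ be the set of infinitely near points to $x$ of kind $\mathbf A$: the smooth morphisms of real algebras $\xi:C^\infty(M)\to\mathbf A$ with $\mathrm{pr}_{\mathbb R}(\xi(f))=f(x)$ for all $f\in C^\infty(M)$, where "smooth" means that $\xi$ maps smooth one-parameter families of functions to smooth curves in $\mathbf A$. Let $M^{\mathbf A}=\bigcup_{x\in M}M^{\mathbf A}_x$, with projection $\pi:M^{\mathbf A}\to M$ and the coarsest topology for which all the maps $\xi\mapsto\xi(f)\in\mathbf A$, $f\in C^\infty(M)$, are continuous. Then $M^{\mathbf A}$ is a (Hausdorff, second countable) smooth real manifold with boundary, of dimension $lm$, whose charts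 are the $(\pi^{-1}(U),(x_{ij}))$ for all smooth charts $(U,(\phi_1,\dots,\phi_m))$ of $M$ with values in the half-space $\{\phi_1\ge 0\}$; here $\xi(\phi_i)=\sum_{j=1}^l x_{ij}(\xi)\,\alpha_j$, the value $\xi(\phi_i)$ being $\xi(f)$ for any $f\in C^\infty(M)$ that equals $\phi_i$ near $\pi(\xi)$, and the charts take values in the half-space $\{x_{11}\ge 0\}$ of $\mathbb R^{lm}$. For this structure, $$\partial(M^{\mathbf A})\neq\emptyset\qquad\text{and}\qquad \bigcup_{x\in\partial M}M^{\mathbf A}_x\subseteq\partial(M^{\mathbf A}).$$ -/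

import Mathlib

open scoped Manifold ContDiff Topology

/-- A finite-dimensional commutative unital real algebra `A` with a distinguished ideal `𝔞` is a
Weil algebra if `A = ℝ·1 ⊕ 𝔞`, where `𝔞` is a maximal ideal with `𝔞 ^ (k + 1) = 0` for some
`k ≥ 1`. -/
structure IsWeilAlgebra (A : Type*) [CommRing A] [Algebra ℝ A] (𝔞 : Ideal A) : Prop where
  finite : Module.Finite ℝ A
  isMaximal : 𝔞.IsMaximal
  isCompl : IsCompl (LinearMap.range (Algebra.linearMap ℝ A)) (𝔞.restrictScalars ℝ)
  nilpotent : ∃ k : ℕ, 1 ≤ k ∧ 𝔞 ^ (k + 1) = ⊥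

/-- A real basis `α₀, …, α_{l-1}` of `A = ℝ·1 ⊕ 𝔞` is adapted to the decomposition if `α₀ = 1` and
the other basis vectors lie in `𝔞`. -/
def IsAdaptedBasis {A : Type*} [CommRing A] [Algebra ℝ A] (𝔞 : Ideal A) {l : ℕ} [NeZero l]
    (b : Module.Basis (Fin l) ℝ A) : Prop :=
  b 0 = 1 ∧ ∀ j : Fin l, j ≠ 0 → b j ∈ 𝔞

section WeilBundle

variable {E : Type*} [NormedAddCommGroup E] [NormedSpace ℝ E]
  {H : Type*} [TopologicalSpace H] (I : ModelWithCorners ℝ E H)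
  (M : Type*) [TopologicalSpace M] [ChartedSpace H M]
  {A : Type*} [CommRing A] [Algebra ℝ A] (𝔞 : Ideal A)

/-- The Weil bundle `M^A`: all points of `M` that are infinitely near of kind `A = ℝ·1 ⊕ 𝔞`.
Such a point, near to `base`, is a smooth morphism `φ : C^∞(M) → A` of real algebras such that
`pr_ℝ ∘ φ` is the evaluation at `base`. -/
@[ext]
structure WeilBundle where
  /-- The image of the point under the bundle projection `M^A → M`. -/
  base : M
  /-- The morphism of real algebras `C^∞(M) → A`. -/
  hom : C^∞⟮I, M; ℝ⟯ →ₐ[ℝ] A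
  /-- The component of `φ f` in `ℝ·1`, along `𝔞`, is `f base`. -/
  near : ∀ f : C^∞⟮I, M; ℝ⟯, hom f - algebraMap ℝ A (f base) ∈ 𝔞
  /-- `φ` is smooth: it maps smooth one-parameter families of functions on `M` to smooth curves in
  the finite-dimensional vector space `A`. -/
  smooth : ∀ c : ℝ → C^∞⟮I, M; ℝ⟯,
    ContMDiff (𝓘(ℝ, ℝ).prod I) 𝓘(ℝ, ℝ) ∞ (fun p : ℝ × M => c p.1 p.2) →
    ∀ lin : Module.Dual ℝ A, ContDiff ℝ ∞ (fun t : ℝ => lin (hom (c t)))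

variable {M} in
/-- The fibre `M^A_x`: the infinitely near points to `x`. -/
def WeilBundle.fibre (x : M) : Set (WeilBundle I M 𝔞) := {ξ | ξ.base = x}

/-- The topology of `M^A`: the coarsest one for which `ξ ↦ ξ f ∈ A` is continuous for every smooth
function `f` on `M`, where the finite-dimensional space `A` has its usual topology (the coarsest
one for which all linear forms are continuous). -/
noncomputable instance WeilBundle.instTopologicalSpace : TopologicalSpace (WeilBundle I M 𝔞) :=
  ⨅ (f : C^∞⟮I, M; ℝ⟯) (lin : Module.Dual ℝ A),
    TopologicalSpace.induced (fun ξ : WeilBundle I M 𝔞 => lin (ξ.hom f)) inferInstance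

end WeilBundle

/-- The canonical real atlas of `M^A`, for an `m`-dimensional smooth manifold `M` with boundary and
a basis `b` of `A`. Its members are the charts `(π⁻¹(U), (x_{i j}))`, for `(U, φ)` a smooth chart of
`M`, whose coordinates are given by `ξ(φ_i) = ∑ j, x_{i j}(ξ) b_j`. They are listed in the order
`x_{0 0}, …, x_{m-1 0}, x_{0 1}, …, x_{m-1 1}, …` and regarded as a point of the half-space
`{x_{0 0} ≥ 0}`. Here `ξ(φ_i)`, for the function `φ_i` defined on `U` only, is the value of `ξ` at
any smooth function on `M` that coincides with `φ_i` near the base point of `ξ`. -/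
def weilAtlas {m : ℕ} [NeZero m] (M : Type*) [TopologicalSpace M]
    [ChartedSpace (EuclideanHalfSpace m) M]
    {A : Type*} [CommRing A] [Algebra ℝ A] (𝔞 : Ideal A)
    {l : ℕ} [NeZero l] (b : Module.Basis (Fin l) ℝ A) :
    Set (OpenPartialHomeomorph (WeilBundle (𝓡∂ m) M 𝔞) (EuclideanHalfSpace (l * m))) :=
  {e | ∃ φ ∈ IsManifold.maximalAtlas (𝓡∂ m) ∞ M,
    e.source = {ξ | ξ.base ∈ φ.source} ∧
    ∀ ξ ∈ e.source, ∀ i : Fin m, ∀ f : C^∞⟮𝓡∂ m, M; ℝ⟯,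
      (∀ᶠ y in 𝓝 ξ.base, f y = (φ y).val i) →
        ξ.hom f = ∑ j : Fin l, (e ξ).val (finProdFinEquiv (j, i)) • b j}

/-! In a chart `φ` of `M`, an infinitely near point is the same thing as a base point together with
increments `N i ∈ 𝔞`, namely the nilpotent parts of its values on the coordinates. The point sends
`f` to the Taylor polynomial of `f` at the base point, evaluated at `N`; nilpotency of `𝔞` makes the
expansion finite.

Uniqueness (`WeilBundle.ext_of_coord`) comes from Hadamard's lemma: two points over the same base
with the same values on the coordinates differ by elements of `𝔞 ^ n` for every `n`, hence not at
all. Existence (`WeilBundle.ofChart`) requires that Taylor expansion be multiplicative, which is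
`taylorSeries_mul` followed by truncation. Both are carried out within a half-space, so that
boundary points need no separate treatment.

The Taylor formula `IsWeilCoord.hom_eq_taylorSum` then shows that `ξ(f)` depends smoothly on the
coordinates of `ξ`. This gives continuity of the inverse charts and smoothness of the transition
maps.

For the boundary, the real part of `ξ(φ_0)` is `φ_0` at the base point, so `x_{00} = φ_0 ∘ π`. Over
`∂M` this coordinate vanishes in every chart, which places `ξ` on the boundary of `M^A`. -/

/-! ### Integrals along segments and Hadamard's lemma on convex sets -/

section Hadamard

open Set

universe u

variable {E G : Type u} [NormedAddCommGroup E] [NormedSpace ℝ E]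
  [NormedAddCommGroup G] [NormedSpace ℝ G]

/-- Clamping the parameter to `[0, 1]` keeps the segment inside `C` for every real `t`, so that
theorems on parametric integrals requiring continuity in all `t` apply. -/
theorem Convex.add_projIcc_smul_sub_mem {C : Set E} (hC : Convex ℝ C) {x y : E} (hx : x ∈ C)
    (hy : y ∈ C) (t : ℝ) :
    x + (projIcc (0 : ℝ) 1 zero_le_one t : ℝ) • (y - x) ∈ C :=
  hC.add_smul_sub_mem hx hy (projIcc (0 : ℝ) 1 zero_le_one t).2

omit [NormedSpace ℝ G] in
/-- A function continuous on a convex set is jointly continuous along the segments issued from a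
point of this set. -/
theorem Convex.continuous_comp_segment {C : Set E} (hC : Convex ℝ C) {x : E} (hx : x ∈ C)
    {F : E → G} (hF : ContinuousOn F C) :
    Continuous fun p : C × ℝ =>
      F (x + (projIcc (0 : ℝ) 1 zero_le_one p.2 : ℝ) • ((p.1 : E) - x)) := by
  refine hF.comp_continuous ?_ fun p => hC.add_projIcc_smul_sub_mem hx p.1.2 p.2
  have : Continuous fun t : ℝ => (projIcc (0 : ℝ) 1 zero_le_one t : ℝ) :=
    continuous_subtype_val.comp continuous_projIcc
  fun_prop

theorem intervalIntegral_segment_eq (F : E → G) (w : ℝ → ℝ) (x y : E) :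
    ∫ t in (0 : ℝ)..1, w t • F (x + t • (y - x)) =
      ∫ t in (0 : ℝ)..1, w t • F (x + (projIcc (0 : ℝ) 1 zero_le_one t : ℝ) • (y - x)) := by
  refine intervalIntegral.integral_congr fun t ht => ?_
  rw [uIcc_of_le zero_le_one] at ht
  simp only [projIcc_of_mem zero_le_one ht]

theorem Convex.continuousOn_integral_segment {C : Set E} (hC : Convex ℝ C) {x : E} (hx : x ∈ C)
    {F : E → G} (hF : ContinuousOn F C) {w : ℝ → ℝ} (hw : Continuous w) :
    ContinuousOn (fun y => ∫ t in (0 : ℝ)..1, w t • F (x + t • (y - x))) C := by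
  simp only [intervalIntegral_segment_eq]
  rw [continuousOn_iff_continuous_domRestrict]
  refine intervalIntegral.continuous_parametric_intervalIntegral_of_continuous'
    (f := fun (y : C) t => w t • F (x + (projIcc (0 : ℝ) 1 zero_le_one t : ℝ) • ((y : E) - x)))
    ?_ 0 1
  exact (hw.comp continuous_snd).smul (hC.continuous_comp_segment hx hF)

theorem Convex.intervalIntegrable_segment {C : Set E} (hC : Convex ℝ C) {x y : E} (hx : x ∈ C)
    (hy : y ∈ C) {F : E → G} (hF : ContinuousOn F C) {w : ℝ → ℝ} (hw : Continuous w) :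
    IntervalIntegrable (fun t => w t • F (x + t • (y - x))) MeasureTheory.volume 0 1 := by
  refine ContinuousOn.intervalIntegrable ?_
  rw [uIcc_of_le zero_le_one]
  refine hw.continuousOn.smul (hF.comp (by fun_prop) fun t ht => ?_)
  exact hC.add_smul_sub_mem hx hy ht

/-- Differentiation under the integral sign with derivatives taken only within `C`. Compactness of
`[0, 1]` makes the continuity of `F'` uniform in `t`, and the mean value inequality on the convex
set `C ∩ ball y δ` turns this into a remainder estimate uniform in `t`. The weight `w` becomes `w t
* t`, so a general weight is what permits iteration. -/
theorem Convex.hasFDerivWithinAt_integral_segment {C : Set E} (hC : Convex ℝ C)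
    {x : E} (hx : x ∈ C) {F : E → G} {F' : E → E →L[ℝ] G}
    (hF : ∀ y ∈ C, HasFDerivWithinAt F (F' y) C y) (hF' : ContinuousOn F' C)
    {w : ℝ → ℝ} (hw : Continuous w) {y : E} (hy : y ∈ C) [CompleteSpace G] :
    HasFDerivWithinAt (fun y => ∫ t in (0 : ℝ)..1, w t • F (x + t • (y - x)))
      (∫ t in (0 : ℝ)..1, (w t * t) • F' (x + t • (y - x))) C y := by
  have hFc : ContinuousOn F C := fun z hz => (hF z hz).continuousWithinAt
  obtain ⟨W, hW⟩ := (isCompact_Icc (a := (0 : ℝ)) (b := 1)).exists_bound_of_continuousOn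
    hw.continuousOn
  have hW0 : 0 ≤ W := (norm_nonneg _).trans (hW 0 (by simp))
  rw [hasFDerivWithinAt_iff_isLittleO, Asymptotics.isLittleO_iff]
  intro ε hε
  -- The `+ 1` keeps the denominator positive when the bound `W` of the weight is zero.
  set ε' : ℝ := ε / (W + 1) with hε'
  have hε'0 : 0 < ε' := by positivity
  have key : ∀ᶠ z in 𝓝[C] y, ∀ t ∈ Icc (0 : ℝ) 1,
      ‖F' (x + t • (z - x)) - F' (x + t • (y - x))‖ < ε' := by
    have hcont := hC.continuous_comp_segment hx hF'
    have h1 : ∀ t ∈ Icc (0 : ℝ) 1, ∀ᶠ p : C × ℝ in 𝓝 ((⟨y, hy⟩ : C), t),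
        ‖F' (x + (projIcc (0 : ℝ) 1 zero_le_one p.2 : ℝ) • ((p.1 : E) - x)) -
          F' (x + (projIcc (0 : ℝ) 1 zero_le_one p.2 : ℝ) • (y - x))‖ < ε' := by
      intro t _
      have h2 : Continuous fun p : C × ℝ =>
          ‖F' (x + (projIcc (0 : ℝ) 1 zero_le_one p.2 : ℝ) • ((p.1 : E) - x)) -
          F' (x + (projIcc (0 : ℝ) 1 zero_le_one p.2 : ℝ) • (y - x))‖ := by
        refine (hcont.sub ?_).norm
        exact hcont.comp (continuous_const (y := (⟨y, hy⟩ : C)).prodMk continuous_snd)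
      refine h2.continuousAt.eventually_lt continuousAt_const ?_
      simpa using hε'0
    have h3 := isCompact_Icc.eventually_forall_of_forall_eventually (P := fun (z : C) (t : ℝ) =>
      ‖F' (x + (projIcc (0 : ℝ) 1 zero_le_one t : ℝ) • ((z : E) - x)) -
        F' (x + (projIcc (0 : ℝ) 1 zero_le_one t : ℝ) • (y - x))‖ < ε') h1
    rw [nhdsWithin_eq_map_subtype_coe hy, Filter.eventually_map]
    filter_upwards [h3] with z hz t ht
    simpa only [projIcc_of_mem zero_le_one ht] using hz t ht
  obtain ⟨δ, hδ, hball⟩ := Metric.mem_nhdsWithin_iff.1 key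
  filter_upwards [inter_mem_nhdsWithin C (Metric.ball_mem_nhds y hδ)] with z hz
  have hzC : z ∈ C := hz.1
  have hest : ∀ t ∈ Icc (0 : ℝ) 1,
      ‖F (x + t • (z - x)) - F (x + t • (y - x)) - (t • F' (x + t • (y - x))) (z - y)‖ ≤
        ε' * ‖z - y‖ := by
    intro t ht
    have hD : ∀ v ∈ C ∩ Metric.ball y δ, HasFDerivWithinAt (fun v => F (x + t • (v - x)))
        (t • F' (x + t • (v - x))) (C ∩ Metric.ball y δ) v := by
      intro v hv
      have h1 : HasFDerivWithinAt (fun v : E => x + t • (v - x))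
          (t • ContinuousLinearMap.id ℝ E) (C ∩ Metric.ball y δ) v :=
        (((hasFDerivWithinAt_id v _).sub_const x).const_smul t).const_add x
      have h2 := (hF _ (hC.add_smul_sub_mem hx hv.1 ht)).comp v h1
        fun v hv => hC.add_smul_sub_mem hx hv.1 ht
      convert! h2 using 1
      ext v
      simp
    have h4 := (hC.inter (convex_ball y δ)).norm_image_sub_le_of_norm_hasFDerivWithin_le'
      (C := ε') (φ := t • F' (x + t • (y - x))) hD (fun v hv => ?_)
      ⟨hy, Metric.mem_ball_self hδ⟩ hz
    · exact h4
    · rw [← smul_sub, norm_smul]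
      have h5 := hball ⟨hv.2, hv.1⟩ t ht
      have h6 : ‖t‖ ≤ 1 := by rw [Real.norm_eq_abs, abs_of_nonneg ht.1]; exact ht.2
      nlinarith [norm_nonneg t, norm_nonneg (F' (x + t • (v - x)) - F' (x + t • (y - x)))]
  have hI : ∀ v ∈ C, IntervalIntegrable (fun t => w t • F (x + t • (v - x)))
      MeasureTheory.volume 0 1 := fun v hv => hC.intervalIntegrable_segment hx hv hFc hw
  have hI' := hC.intervalIntegrable_segment hx hy hF' (hw.mul continuous_id)
  have happ : (∫ t in (0 : ℝ)..1, (w t * t) • F' (x + t • (y - x))) (z - y) =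
      ∫ t in (0 : ℝ)..1, ((w t * t) • F' (x + t • (y - x))) (z - y) :=
    ContinuousLinearMap.intervalIntegral_apply hI' _
  have hI'' : IntervalIntegrable (fun t => ((w t * t) • F' (x + t • (y - x))) (z - y))
      MeasureTheory.volume 0 1 :=
    ⟨(ContinuousLinearMap.apply ℝ G (z - y)).integrable_comp hI'.1,
      (ContinuousLinearMap.apply ℝ G (z - y)).integrable_comp hI'.2⟩
  rw [happ, ← intervalIntegral.integral_sub (hI z hzC) (hI y hy),
    ← intervalIntegral.integral_sub ((hI z hzC).sub (hI y hy)) hI'']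
  refine (intervalIntegral.norm_integral_le_of_norm_le_const (C := ε * ‖z - y‖) ?_).trans (by simp)
  intro t ht
  rw [uIoc_of_le zero_le_one] at ht
  have ht' : t ∈ Icc (0 : ℝ) 1 := Ioc_subset_Icc_self ht
  have h7 : w t • F (x + t • (z - x)) - w t • F (x + t • (y - x)) -
      ((w t * t) • F' (x + t • (y - x))) (z - y) =
      w t • (F (x + t • (z - x)) - F (x + t • (y - x)) -
        (t • F' (x + t • (y - x))) (z - y)) := by
    simp [smul_sub, mul_smul]
  rw [h7, norm_smul]
  calc ‖w t‖ * _ ≤ (W + 1) * (ε' * ‖z - y‖) := by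
        gcongr
        · exact (hW t ht').trans (by linarith)
        · exact hest t ht'
    _ = ε * ‖z - y‖ := by rw [hε']; field_simp

/-- The codomain and the weight are quantified inside the induction: the derivative is an integral
of the same kind, with values in `E →L[ℝ] G` and weight `w t * t`. The common universe of `E` and
`G` lets the hypothesis apply to that codomain. -/
theorem Convex.contDiffOn_nat_integral_segment {C : Set E} (hC : Convex ℝ C)
    (hU : UniqueDiffOn ℝ C) {x : E} (hx : x ∈ C) (n : ℕ) :
    ∀ {G : Type u} [NormedAddCommGroup G] [NormedSpace ℝ G] [CompleteSpace G] {F : E → G}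
      (_ : ContDiffOn ℝ n F C) {w : ℝ → ℝ} (_ : Continuous w),
      ContDiffOn ℝ n (fun y => ∫ t in (0 : ℝ)..1, w t • F (x + t • (y - x))) C := by
  induction n with
  | zero =>
    intro G _ _ _ F hF w hw
    simp only [CharP.cast_eq_zero, contDiffOn_zero] at hF ⊢
    exact hC.continuousOn_integral_segment hx hF hw
  | succ n ih =>
    intro G _ _ _ F hF w hw
    push_cast at hF ⊢
    rw [contDiffOn_succ_iff_hasFDerivWithinAt_of_uniqueDiffOn hU] at hF ⊢
    obtain ⟨_, F', hF', hder⟩ := hF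
    refine ⟨by simp, _, ih hF' (hw.mul continuous_id), fun y hy => ?_⟩
    exact hC.hasFDerivWithinAt_integral_segment hx hder hF'.continuousOn hw hy

theorem Convex.contDiffOn_integral_segment {C : Set E} (hC : Convex ℝ C)
    (hU : UniqueDiffOn ℝ C) {x : E} (hx : x ∈ C) [CompleteSpace G] {F : E → G}
    (hF : ContDiffOn ℝ ∞ F C) :
    ContDiffOn ℝ ∞ (fun y => ∫ t in (0 : ℝ)..1, F (x + t • (y - x))) C := by
  rw [contDiffOn_infty] at hF ⊢
  intro n
  simpa using hC.contDiffOn_nat_integral_segment hU hx n (hF n) (w := fun _ => 1)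
    continuous_const

theorem Convex.sub_eq_integral_fderivWithin {C : Set E} (hC : Convex ℝ C)
    {x y : E} (hx : x ∈ C) (hy : y ∈ C) [CompleteSpace G] {F : E → G} {F' : E → E →L[ℝ] G}
    (hF : ∀ y ∈ C, HasFDerivWithinAt F (F' y) C y) (hF' : ContinuousOn F' C) :
    F y - F x = (∫ t in (0 : ℝ)..1, F' (x + t • (y - x))) (y - x) := by
  have hI := hC.intervalIntegrable_segment hx hy hF' (w := fun _ => 1) continuous_const
  simp only [one_smul] at hI
  rw [ContinuousLinearMap.intervalIntegral_apply hI]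
  have hI' : IntervalIntegrable (fun t => F' (x + t • (y - x)) (y - x))
      MeasureTheory.volume 0 1 :=
    ⟨(ContinuousLinearMap.apply ℝ G (y - x)).integrable_comp hI.1,
      (ContinuousLinearMap.apply ℝ G (y - x)).integrable_comp hI.2⟩
  have hd : ∀ t ∈ Icc (0 : ℝ) 1, HasDerivWithinAt (fun t : ℝ => F (x + t • (y - x)))
      (F' (x + t • (y - x)) (y - x)) (Icc 0 1) t := by
    intro t ht
    have h1 : HasDerivWithinAt (fun t : ℝ => x + t • (y - x)) ((1 : ℝ) • (y - x)) (Icc 0 1) t :=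
      ((hasDerivWithinAt_id t _).smul_const (y - x)).const_add x
    rw [one_smul] at h1
    exact (hF _ (hC.add_smul_sub_mem hx hy ht)).comp_hasDerivWithinAt t h1
      fun s hs => hC.add_smul_sub_mem hx hy hs
  have h := intervalIntegral.integral_eq_sub_of_hasDerivAt_of_le zero_le_one
    (fun t ht => (hd t ht).continuousWithinAt)
    (fun t ht => (hd t (Ioo_subset_Icc_self ht)).hasDerivAt (Icc_mem_nhds ht.1 ht.2)) hI'
  simpa using h.symm

/-- **Hadamard's lemma** on a convex set with unique derivatives, such as a half-space. -/
theorem Convex.exists_eq_add_sum_sub_mul {m : ℕ} {C : Set (EuclideanSpace ℝ (Fin m))}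
    (hC : Convex ℝ C) (hU : UniqueDiffOn ℝ C) {x : EuclideanSpace ℝ (Fin m)} (hx : x ∈ C)
    {F : EuclideanSpace ℝ (Fin m) → ℝ} (hF : ContDiffOn ℝ ∞ F C) :
    ∃ g : Fin m → EuclideanSpace ℝ (Fin m) → ℝ, (∀ i, ContDiffOn ℝ ∞ (g i) C) ∧
      ∀ y ∈ C, F y = F x + ∑ i, (y i - x i) * g i y := by
  obtain ⟨hd, hF'⟩ := (contDiffOn_infty_iff_fderivWithin hU).1 hF
  let K : EuclideanSpace ℝ (Fin m) → EuclideanSpace ℝ (Fin m) →L[ℝ] ℝ :=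
    fun y => ∫ t in (0 : ℝ)..1, fderivWithin ℝ F C (x + t • (y - x))
  have hKs : ContDiffOn ℝ ∞ K C := hC.contDiffOn_integral_segment hU hx hF'
  refine ⟨fun i y => K y (EuclideanSpace.single i 1), fun i => hKs.clm_apply contDiffOn_const,
    fun y hy => ?_⟩
  have h := hC.sub_eq_integral_fderivWithin hx hy (fun z hz => (hd z hz).hasFDerivWithinAt)
    hF'.continuousOn
  have h2 : y - x = ∑ i, (y i - x i) • EuclideanSpace.single i (1 : ℝ) := by
    ext j
    simp [Finset.sum_apply, Pi.single_apply]
  rw [← sub_eq_iff_eq_add', h]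
  change K y (y - x) = _
  conv_lhs => rw [h2]
  simp [map_sum]

end Hadamard

/-! ### Smoothness of maps into a real algebra, tested by linear forms -/

section WeaklySmooth

variable {P : Type*} [NormedAddCommGroup P] [NormedSpace ℝ P]
  {A : Type*} [CommRing A] [Algebra ℝ A]

/-- A map into a real algebra is weakly smooth on a set if its composites with all linear forms
are smooth there. -/
def WeaklySmoothOn (g : P → A) (s : Set P) : Prop :=
  ∀ lin : Module.Dual ℝ A, ContDiffOn ℝ ∞ (fun p => lin (g p)) s

namespace WeaklySmoothOn

variable {s : Set P} {g h : P → A}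

theorem algebraMap {c : P → ℝ} (hc : ContDiffOn ℝ ∞ c s) :
    WeaklySmoothOn (fun p => algebraMap ℝ A (c p)) s := by
  intro lin
  simp only [Algebra.algebraMap_eq_smul_one, map_smul, smul_eq_mul]
  exact hc.mul contDiffOn_const

theorem const (a : A) : WeaklySmoothOn (fun _ : P => a) s := fun _ => contDiffOn_const

theorem sum {ι : Type*} {t : Finset ι} {g : ι → P → A} (hg : ∀ i ∈ t, WeaklySmoothOn (g i) s) :
    WeaklySmoothOn (fun p => ∑ i ∈ t, g i p) s := by
  intro lin
  simp only [map_sum]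
  exact ContDiffOn.sum fun i hi => hg i hi lin

theorem mul [Module.Finite ℝ A] (hg : WeaklySmoothOn g s) (hh : WeaklySmoothOn h s) :
    WeaklySmoothOn (fun p => g p * h p) s := by
  intro lin
  let b := Module.finBasis ℝ A
  -- In a finite basis the product is bilinear in the coordinates, which are themselves linear
  -- forms.
  have : ∀ p, lin (g p * h p) =
      ∑ i, ∑ j, b.coord i (g p) * b.coord j (h p) * lin (b i * b j) := by
    intro p
    conv_lhs => rw [← b.sum_repr (g p), ← b.sum_repr (h p), Finset.sum_mul_sum]
    simp [map_sum, mul_assoc, mul_left_comm]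
  simp only [this]
  exact ContDiffOn.sum fun i _ => ContDiffOn.sum fun j _ =>
    ((hg _).mul (hh _)).mul contDiffOn_const

theorem const_smul (c : ℝ) (hg : WeaklySmoothOn g s) : WeaklySmoothOn (fun p => c • g p) s := by
  intro lin
  simp only [map_smul, smul_eq_mul]
  exact contDiffOn_const.mul (hg lin)

theorem smul_const {c : P → ℝ} (hc : ContDiffOn ℝ ∞ c s) (a : A) :
    WeaklySmoothOn (fun p => c p • a) s := by
  intro lin
  simp only [map_smul, smul_eq_mul]
  exact hc.mul contDiffOn_const

end WeaklySmoothOn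

end WeaklySmooth

/-! ### Algebra-valued Taylor expansion within a set -/

section TaylorExpansion

open Set Function

variable {m : ℕ}

/-- The `i`-th partial derivative within a set. -/
noncomputable def partialDerivWithin (S : Set (EuclideanSpace ℝ (Fin m))) (i : Fin m)
    (F : EuclideanSpace ℝ (Fin m) → ℝ) : EuclideanSpace ℝ (Fin m) → ℝ :=
  fun y => fderivWithin ℝ F S y (EuclideanSpace.single i 1)

variable {S u : Set (EuclideanSpace ℝ (Fin m))} {F G : EuclideanSpace ℝ (Fin m) → ℝ}
  {x : EuclideanSpace ℝ (Fin m)}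

/-- Joint smoothness in the parameter and the point lets a family of functions be differentiated
repeatedly. Since `u` is open, derivatives within `S` and within `S ∩ u` agree on `S ∩ u`. -/
theorem contDiffOn_uncurry_partialDerivWithin {P : Type*} [NormedAddCommGroup P] [NormedSpace ℝ P]
    (hS : UniqueDiffOn ℝ S) (hu : IsOpen u) {s : Set P} {F : P → EuclideanSpace ℝ (Fin m) → ℝ}
    (hF : ContDiffOn ℝ ∞ (uncurry F) (s ×ˢ (S ∩ u))) (i : Fin m) :
    ContDiffOn ℝ ∞ (uncurry fun p => partialDerivWithin S i (F p)) (s ×ˢ (S ∩ u)) := by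
  rintro ⟨p, y⟩ ⟨hp, hy⟩
  have h : ContDiffWithinAt ℝ ∞
      (fun q : P × EuclideanSpace ℝ (Fin m) => fderivWithin ℝ (F q.1) (S ∩ u) q.2)
      (s ×ˢ (S ∩ u)) (p, y) := by
    refine ContDiffWithinAt.fderivWithin (n := ∞) (g := Prod.snd) ?_ contDiffWithinAt_snd
      (hS.inter hu) (by simp) ⟨hp, hy⟩ fun q hq => hq.2
    refine (hF (p, y) ⟨hp, hy⟩).comp (g := uncurry F)
      (f := fun q : (P × EuclideanSpace ℝ (Fin m)) × EuclideanSpace ℝ (Fin m) => (q.1.1, q.2))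
      ((p, y), y) (by fun_prop) fun q hq => ⟨hq.1.1, hq.2⟩
  refine (h.clm_apply (contDiffWithinAt_const (c := EuclideanSpace.single i (1 : ℝ)))).congr
    ?_ ?_
  · intro q hq
    simp only [uncurry, partialDerivWithin]
    rw [fderivWithin_inter (hu.mem_nhds hq.2.2)]
  · simp only [uncurry, partialDerivWithin]
    rw [fderivWithin_inter (hu.mem_nhds hy.2)]

theorem ContDiffOn.partialDerivWithin (hF : ContDiffOn ℝ ∞ F (S ∩ u)) (hS : UniqueDiffOn ℝ S)
    (hu : IsOpen u) (i : Fin m) : ContDiffOn ℝ ∞ (partialDerivWithin S i F) (S ∩ u) := by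
  have h := contDiffOn_uncurry_partialDerivWithin (P := ℝ) (s := univ) hS hu (F := fun _ => F)
    (hF.comp contDiffOn_snd fun q hq => hq.2) i
  exact h.comp (f := fun y => ((0 : ℝ), y)) (by fun_prop) fun y hy => ⟨mem_univ _, hy⟩

theorem Filter.EventuallyEq.partialDerivWithin (h : F =ᶠ[𝓝[S] x] G) (i : Fin m) :
    partialDerivWithin S i F =ᶠ[𝓝[S] x] partialDerivWithin S i G := by
  filter_upwards [h.fderivWithin (𝕜 := ℝ)] with y hy
  simp only [_root_.partialDerivWithin, hy]

theorem ContDiffOn.differentiableWithinAt_of_inter (hF : ContDiffOn ℝ ∞ F (S ∩ u))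
    (hu : IsOpen u) {y : EuclideanSpace ℝ (Fin m)} (hy : y ∈ S ∩ u) :
    DifferentiableWithinAt ℝ F S y :=
  (differentiableWithinAt_inter (hu.mem_nhds hy.2)).1 (hF.differentiableOn (by simp) y hy)

theorem eventuallyEq_partialDerivWithin_add (hS : UniqueDiffOn ℝ S) (hu : IsOpen u)
    (hF : ContDiffOn ℝ ∞ F (S ∩ u)) (hG : ContDiffOn ℝ ∞ G (S ∩ u)) (hx : x ∈ u) (i : Fin m) :
    partialDerivWithin S i (F + G) =ᶠ[𝓝[S] x]
      partialDerivWithin S i F + partialDerivWithin S i G := by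
  filter_upwards [inter_mem_nhdsWithin S (hu.mem_nhds hx)] with y hy
  simp [partialDerivWithin, fderivWithin_add (hS y hy.1)
    (hF.differentiableWithinAt_of_inter hu hy) (hG.differentiableWithinAt_of_inter hu hy)]

theorem eventuallyEq_partialDerivWithin_mul (hS : UniqueDiffOn ℝ S) (hu : IsOpen u)
    (hF : ContDiffOn ℝ ∞ F (S ∩ u)) (hG : ContDiffOn ℝ ∞ G (S ∩ u)) (hx : x ∈ u) (i : Fin m) :
    partialDerivWithin S i (F * G) =ᶠ[𝓝[S] x]
      partialDerivWithin S i F * G + F * partialDerivWithin S i G := by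
  filter_upwards [inter_mem_nhdsWithin S (hu.mem_nhds hx)] with y hy
  simp [partialDerivWithin, fderivWithin_mul (hS y hy.1)
    (hF.differentiableWithinAt_of_inter hu hy) (hG.differentiableWithinAt_of_inter hu hy)]
  ring

variable {A : Type*} [CommRing A] [Algebra ℝ A]

/-- The term of degree `n` of the Taylor expansion of `F` at `x` within `S`, without its factor
`1 / n!`, evaluated at an increment `N` with components in a real algebra. -/
noncomputable def taylorTerm (S : Set (EuclideanSpace ℝ (Fin m))) (N : Fin m → A)
    (x : EuclideanSpace ℝ (Fin m)) : ℕ → (EuclideanSpace ℝ (Fin m) → ℝ) → A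
  | 0, F => algebraMap ℝ A (F x)
  | n + 1, F => ∑ i, N i * taylorTerm S N x n (partialDerivWithin S i F)

variable {N : Fin m → A}

theorem taylorTerm_congr (hx : x ∈ S) (n : ℕ) (h : F =ᶠ[𝓝[S] x] G) :
    taylorTerm S N x n F = taylorTerm S N x n G := by
  induction n generalizing F G with
  | zero => simp only [taylorTerm, h.self_of_nhdsWithin hx]
  | succ n ih => simp only [taylorTerm, ih (h.partialDerivWithin _)]

theorem taylorTerm_add (hS : UniqueDiffOn ℝ S) (hu : IsOpen u) (hx : x ∈ S ∩ u) (n : ℕ)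
    (hF : ContDiffOn ℝ ∞ F (S ∩ u)) (hG : ContDiffOn ℝ ∞ G (S ∩ u)) :
    taylorTerm S N x n (F + G) = taylorTerm S N x n F + taylorTerm S N x n G := by
  induction n generalizing F G with
  | zero => simp [taylorTerm]
  | succ n ih =>
    simp only [taylorTerm, ← Finset.sum_add_distrib, ← mul_add]
    refine Finset.sum_congr rfl fun i _ => ?_
    rw [taylorTerm_congr hx.1 n (eventuallyEq_partialDerivWithin_add hS hu hF hG hx.2 i),
      ih (hF.partialDerivWithin hS hu i) (hG.partialDerivWithin hS hu i)]

/-- The generating series of the terms of the Taylor expansion. -/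
noncomputable def taylorSeries (S : Set (EuclideanSpace ℝ (Fin m))) (N : Fin m → A)
    (x : EuclideanSpace ℝ (Fin m)) (F : EuclideanSpace ℝ (Fin m) → ℝ) : PowerSeries A :=
  PowerSeries.mk fun n => (n.factorial : ℝ)⁻¹ • taylorTerm S N x n F

theorem coeff_taylorSeries (n : ℕ) :
    PowerSeries.coeff n (taylorSeries S N x F) =
      (n.factorial : ℝ)⁻¹ • taylorTerm S N x n F := by
  simp [taylorSeries]

theorem coeff_taylorSeries_succ (n : ℕ) :
    PowerSeries.coeff (n + 1) (taylorSeries S N x F) * (n + 1) =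
      ∑ i, N i * PowerSeries.coeff n (taylorSeries S N x (partialDerivWithin S i F)) := by
  have h : ((n : A) + 1) = algebraMap ℝ A (n + 1) := by simp
  simp only [coeff_taylorSeries, taylorTerm, mul_smul_comm, ← Finset.smul_sum]
  rw [h, mul_comm, ← Algebra.smul_def, smul_smul]
  congr 1
  rw [Nat.factorial_succ]
  push_cast
  field_simp

/-- The formal counterpart of `d/dt F(x + tN) = ∑ N_i (∂_i F)(x + tN)`. -/
theorem derivative_taylorSeries :
    PowerSeries.derivative A (taylorSeries S N x F) =
      ∑ i, PowerSeries.C (N i) * taylorSeries S N x (partialDerivWithin S i F) := by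
  ext n
  simp [PowerSeries.coeff_derivative, coeff_taylorSeries_succ, map_sum]

theorem taylorSeries_congr (hx : x ∈ S) (h : F =ᶠ[𝓝[S] x] G) :
    taylorSeries S N x F = taylorSeries S N x G := by
  ext n
  simp only [coeff_taylorSeries, taylorTerm_congr hx n h]

theorem taylorSeries_add (hS : UniqueDiffOn ℝ S) (hu : IsOpen u) (hx : x ∈ S ∩ u)
    (hF : ContDiffOn ℝ ∞ F (S ∩ u)) (hG : ContDiffOn ℝ ∞ G (S ∩ u)) :
    taylorSeries S N x (F + G) = taylorSeries S N x F + taylorSeries S N x G := by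
  ext n
  simp only [coeff_taylorSeries, map_add, taylorTerm_add hS hu hx n hF hG, smul_add]

/-- By the Leibniz rule both sides obey the same differential equation with the same constant term.
Coefficients are compared by induction, for all `F` and `G` at once, cancelling `n + 1`, which is a
unit in a real algebra. This avoids multi-index combinatorics. -/
theorem taylorSeries_mul (hS : UniqueDiffOn ℝ S) (hu : IsOpen u) (hx : x ∈ S ∩ u)
    (hF : ContDiffOn ℝ ∞ F (S ∩ u)) (hG : ContDiffOn ℝ ∞ G (S ∩ u)) :
    taylorSeries S N x (F * G) = taylorSeries S N x F * taylorSeries S N x G := by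
  ext n
  induction n generalizing F G with
  | zero => simp [PowerSeries.coeff_mul, coeff_taylorSeries, taylorTerm]
  | succ n ih =>
    have hunit : IsUnit ((n : A) + 1) := by
      have h : ((n : A) + 1) = algebraMap ℝ A (n + 1) := by simp
      rw [h]
      exact (IsUnit.mk0 _ (by positivity)).map _
    rw [← hunit.mul_left_inj, coeff_taylorSeries_succ, ← PowerSeries.coeff_derivative]
    simp only [Derivation.leibniz, derivative_taylorSeries, smul_eq_mul, map_add,
      Finset.mul_sum, map_sum]
    rw [← Finset.sum_add_distrib]
    refine Finset.sum_congr rfl fun i _ => ?_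
    have hFi := hF.partialDerivWithin hS hu i
    have hGi := hG.partialDerivWithin hS hu i
    rw [taylorSeries_congr hx.1 (eventuallyEq_partialDerivWithin_mul hS hu hF hG hx.2 i),
      taylorSeries_add hS hu hx (F := partialDerivWithin S i F * G)
        (G := F * partialDerivWithin S i G) (hFi.mul hG) (hF.mul hGi), map_add, ih hFi hG,
      ih hF hGi, mul_left_comm, PowerSeries.coeff_C_mul, mul_left_comm (taylorSeries S N x G),
      PowerSeries.coeff_C_mul, mul_comm (taylorSeries S N x G), mul_add, add_comm]

theorem taylorTerm_mem_pow {𝔞 : Ideal A} (hN : ∀ i, N i ∈ 𝔞) (n : ℕ) :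
    taylorTerm S N x n F ∈ 𝔞 ^ n := by
  induction n generalizing F with
  | zero => simp
  | succ n ih =>
    rw [pow_succ']
    exact Ideal.sum_mem _ fun i _ => Ideal.mul_mem_mul (hN i) ih

/-- The value at an increment `N` of the Taylor expansion of `F` at `x` within `S` in degrees
less than `K`. -/
noncomputable def taylorSum (S : Set (EuclideanSpace ℝ (Fin m))) (N : Fin m → A)
    (x : EuclideanSpace ℝ (Fin m)) (K : ℕ) (F : EuclideanSpace ℝ (Fin m) → ℝ) : A :=
  ∑ n ∈ Finset.range K, PowerSeries.coeff n (taylorSeries S N x F)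

variable {K : ℕ}

theorem taylorSum_congr (hx : x ∈ S) (h : F =ᶠ[𝓝[S] x] G) :
    taylorSum S N x K F = taylorSum S N x K G := by
  simp only [taylorSum, taylorSeries_congr hx h]

theorem taylorSum_add (hS : UniqueDiffOn ℝ S) (hu : IsOpen u) (hx : x ∈ S ∩ u)
    (hF : ContDiffOn ℝ ∞ F (S ∩ u)) (hG : ContDiffOn ℝ ∞ G (S ∩ u)) :
    taylorSum S N x K (F + G) = taylorSum S N x K F + taylorSum S N x K G := by
  simp only [taylorSum, taylorSeries_add hS hu hx hF hG, map_add, Finset.sum_add_distrib]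

/-- The terms of the product of the truncations with `p + q ≥ K` lie in `I ^ (p + q) ≤ I ^ K = ⊥`;
the remaining ones, grouped by `p + q`, are the coefficients of the product. -/
theorem sum_range_coeff_mul {R : Type*} [CommRing R] {I : Ideal R} (hI : I ^ K = ⊥)
    {f g : PowerSeries R} (hf : ∀ n, PowerSeries.coeff n f ∈ I ^ n)
    (hg : ∀ n, PowerSeries.coeff n g ∈ I ^ n) :
    ∑ n ∈ Finset.range K, PowerSeries.coeff n (f * g) =
      (∑ n ∈ Finset.range K, PowerSeries.coeff n f) *
        ∑ n ∈ Finset.range K, PowerSeries.coeff n g := by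
  have hne : ∀ q ∈ Finset.range K ×ˢ Finset.range K,
      PowerSeries.coeff q.1 f * PowerSeries.coeff q.2 g ≠ 0 → q.1 + q.2 < K := by
    intro q _ hq
    by_contra! hK
    refine hq ?_
    have h1 : PowerSeries.coeff q.1 f * PowerSeries.coeff q.2 g ∈ I ^ (q.1 + q.2) := by
      rw [pow_add]
      exact Ideal.mul_mem_mul (hf _) (hg _)
    have h2 := Ideal.pow_le_pow_right hK h1
    rwa [hI, Ideal.mem_bot] at h2
  have hmaps : ∀ q ∈ (Finset.range K ×ˢ Finset.range K).filter (fun q => q.1 + q.2 < K),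
      q.1 + q.2 ∈ Finset.range K := by simp
  rw [Finset.sum_mul_sum, ← Finset.sum_product', ← Finset.sum_filter_of_ne hne,
    ← Finset.sum_fiberwise_of_maps_to hmaps]
  refine Finset.sum_congr rfl fun n hn => ?_
  rw [PowerSeries.coeff_mul]
  refine Finset.sum_congr ?_ fun _ _ => rfl
  ext ⟨p, q⟩
  simp only [Finset.mem_range] at hn
  simp only [Finset.HasAntidiagonal.mem_antidiagonal, Finset.mem_filter, Finset.mem_product,
    Finset.mem_range]
  omega

theorem coeff_taylorSeries_mem_pow {𝔞 : Ideal A} (hN : ∀ i, N i ∈ 𝔞) (n : ℕ) :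
    PowerSeries.coeff n (taylorSeries S N x F) ∈ 𝔞 ^ n := by
  rw [coeff_taylorSeries]
  exact Submodule.smul_of_tower_mem _ _ (taylorTerm_mem_pow hN n)

theorem taylorSum_mul {𝔞 : Ideal A} (hK : 𝔞 ^ K = ⊥) (hN : ∀ i, N i ∈ 𝔞)
    (hS : UniqueDiffOn ℝ S) (hu : IsOpen u) (hx : x ∈ S ∩ u)
    (hF : ContDiffOn ℝ ∞ F (S ∩ u)) (hG : ContDiffOn ℝ ∞ G (S ∩ u)) :
    taylorSum S N x K (F * G) = taylorSum S N x K F * taylorSum S N x K G := by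
  simp only [taylorSum, taylorSeries_mul hS hu hx hF hG]
  exact sum_range_coeff_mul hK (coeff_taylorSeries_mem_pow hN) (coeff_taylorSeries_mem_pow hN)

theorem partialDerivWithin_const (c : ℝ) (i : Fin m) :
    partialDerivWithin S i (fun _ => c) = fun _ => 0 := by
  ext y
  simp [partialDerivWithin]

theorem taylorTerm_zero (n : ℕ) : taylorTerm S N x n (fun _ => 0) = 0 := by
  induction n with
  | zero => simp [taylorTerm]
  | succ n ih => simp [taylorTerm, partialDerivWithin_const, ih]

theorem taylorTerm_succ_const (c : ℝ) (n : ℕ) :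
    taylorTerm S N x (n + 1) (fun _ => c) = 0 := by
  simp [taylorTerm, partialDerivWithin_const, taylorTerm_zero]

theorem taylorSum_const (hK : K ≠ 0) (c : ℝ) :
    taylorSum S N x K (fun _ => c) = algebraMap ℝ A c := by
  obtain ⟨K, rfl⟩ := Nat.exists_eq_succ_of_ne_zero hK
  simp [taylorSum, Finset.sum_range_succ', coeff_taylorSeries, taylorTerm_succ_const]
  simp [taylorTerm]

theorem taylorSum_sub_mem {𝔞 : Ideal A} (hN : ∀ i, N i ∈ 𝔞) (hK : K ≠ 0) :
    taylorSum S N x K F - algebraMap ℝ A (F x) ∈ 𝔞 := by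
  obtain ⟨K, rfl⟩ := Nat.exists_eq_succ_of_ne_zero hK
  rw [taylorSum, Finset.sum_range_succ', coeff_taylorSeries]
  simp only [Nat.factorial_zero, Nat.cast_one, inv_one, one_smul, taylorTerm, add_sub_cancel_right]
  exact Ideal.sum_mem _ fun n _ =>
    Ideal.pow_le_self n.succ_ne_zero (coeff_taylorSeries_mem_pow hN (n + 1))

theorem eventuallyEq_partialDerivWithin_coord (hS : UniqueDiffOn ℝ S) (i j : Fin m) :
    partialDerivWithin S i (fun y => y j) =ᶠ[𝓝[S] x] fun _ => if i = j then 1 else 0 := by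
  filter_upwards [self_mem_nhdsWithin] with y hy
  have h : HasFDerivWithinAt (fun y : EuclideanSpace ℝ (Fin m) => y j)
      (EuclideanSpace.proj j : EuclideanSpace ℝ (Fin m) →L[ℝ] ℝ) S y :=
    (EuclideanSpace.proj j : EuclideanSpace ℝ (Fin m) →L[ℝ] ℝ).hasFDerivWithinAt
  simp only [partialDerivWithin, h.fderivWithin (hS y hy)]
  simp [eq_comm]

/-- The bound `2 ≤ K` retains the linear term, which carries `N j`; all higher terms vanish. -/
theorem taylorSum_coord (hS : UniqueDiffOn ℝ S) (hx : x ∈ S) (hK : 2 ≤ K) (j : Fin m) :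
    taylorSum S N x K (fun y => y j) = algebraMap ℝ A (x j) + N j := by
  obtain ⟨K, rfl⟩ := Nat.exists_eq_add_of_le' hK
  have h : ∀ n, taylorTerm S N x (n + 1) (fun y => y j) =
      ∑ i, N i * taylorTerm S N x n (fun _ => if i = j then 1 else 0) := fun n => by
    simp only [taylorTerm]
    exact Finset.sum_congr rfl fun i _ => by
      rw [taylorTerm_congr hx n (eventuallyEq_partialDerivWithin_coord hS i j)]
  rw [taylorSum, Finset.sum_range_succ', Finset.sum_range_succ']
  simp only [coeff_taylorSeries, h, taylorTerm_succ_const]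
  simp [taylorTerm, add_comm]

theorem weaklySmoothOn_taylorSum [Module.Finite ℝ A] {P : Type*} [NormedAddCommGroup P]
    [NormedSpace ℝ P] (hS : UniqueDiffOn ℝ S) (hu : IsOpen u) {s : Set P}
    {F : P → EuclideanSpace ℝ (Fin m) → ℝ} (hF : ContDiffOn ℝ ∞ (uncurry F) (s ×ˢ (S ∩ u)))
    {x : P → EuclideanSpace ℝ (Fin m)} (hx : ContDiffOn ℝ ∞ x s) (hxS : MapsTo x s (S ∩ u))
    {N : P → Fin m → A} (hN : ∀ i, WeaklySmoothOn (fun p => N p i) s) (K : ℕ) :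
    WeaklySmoothOn (fun p => taylorSum S (N p) (x p) K (F p)) s := by
  have key : ∀ n : ℕ, ∀ {F : P → EuclideanSpace ℝ (Fin m) → ℝ},
      ContDiffOn ℝ ∞ (uncurry F) (s ×ˢ (S ∩ u)) →
      WeaklySmoothOn (fun p => taylorTerm S (N p) (x p) n (F p)) s := by
    intro n
    induction n with
    | zero =>
      intro F hF
      simp only [taylorTerm]
      exact .algebraMap (hF.comp (f := fun p => (p, x p)) (contDiffOn_id.prodMk hx)
        fun p hp => ⟨hp, hxS hp⟩)
    | succ n ih =>
      intro F hF
      simp only [taylorTerm]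
      exact .sum fun i _ =>
        (hN i).mul (ih (contDiffOn_uncurry_partialDerivWithin hS hu hF i))
  simp only [taylorSum, coeff_taylorSeries]
  exact .sum fun n _ => (key n hF).const_smul _

end TaylorExpansion

/-! ### Infinitely near points depend on germs and are determined by coordinates -/

section Germs

open Set Function

variable {m : ℕ} [NeZero m] {M : Type*} [TopologicalSpace M]
  [ChartedSpace (EuclideanHalfSpace m) M]

theorem exists_contMDiffMap_eq_one_tsupport_subset [T2Space M] [IsManifold (𝓡∂ m) ∞ M] {x : M}
    {U : Set M} (hU : U ∈ 𝓝 x) :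
    ∃ χ : C^∞⟮𝓡∂ m, M; ℝ⟯, tsupport χ ⊆ U ∧ ∀ᶠ y in 𝓝 x, χ y = 1 := by
  obtain ⟨χ, -, hχ⟩ := ((SmoothBumpFunction.nhds_basis_tsupport (I := 𝓡∂ m) x).mem_iff' U).1 hU
  exact ⟨⟨χ, χ.contMDiff⟩, hχ, χ.eventuallyEq_one⟩

/-- A function that is smooth near a point coincides near this point with a globally smooth one. -/
theorem ContMDiffOn.exists_contMDiffMap_eventuallyEq [T2Space M] [IsManifold (𝓡∂ m) ∞ M]
    {g : M → ℝ} {U : Set M} (hg : ContMDiffOn (𝓡∂ m) 𝓘(ℝ, ℝ) ∞ g U) (hU : IsOpen U) {x : M}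
    (hx : x ∈ U) : ∃ f : C^∞⟮𝓡∂ m, M; ℝ⟯, ∀ᶠ y in 𝓝 x, f y = g y := by
  obtain ⟨χ, hχ, h1⟩ := exists_contMDiffMap_eq_one_tsupport_subset (m := m) (hU.mem_nhds hx)
  refine ⟨⟨fun y => χ y • g y, contMDiff_of_tsupport fun y hy => ?_⟩, ?_⟩
  · have hyU : y ∈ U := hχ (tsupport_smul_subset_left _ _ hy)
    exact χ.contMDiff.contMDiffAt.smul ((hg y hyU).contMDiffAt (hU.mem_nhds hyU))
  · filter_upwards [h1] with y hy
    simp [hy]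

theorem IsWeilAlgebra.isUnit_of_sub_one_mem {A : Type*} [CommRing A] [Algebra ℝ A] {𝔞 : Ideal A}
    (hA : IsWeilAlgebra A 𝔞) {a : A} (ha : a - 1 ∈ 𝔞) : IsUnit a := by
  obtain ⟨k, -, hk⟩ := hA.nilpotent
  have hnil : IsNilpotent (a - 1) := ⟨k + 1, by
    simpa [hk] using Ideal.pow_mem_pow ha (k + 1)⟩
  simpa using hnil.isUnit_add_one

theorem IsWeilAlgebra.eq_zero_of_algebraMap_mem {A : Type*} [CommRing A] [Algebra ℝ A]
    {𝔞 : Ideal A} (hA : IsWeilAlgebra A 𝔞) {c : ℝ} (hc : algebraMap ℝ A c ∈ 𝔞) : c = 0 := by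
  by_contra h
  exact hA.isMaximal.ne_top (Ideal.eq_top_of_isUnit_mem _ hc ((IsUnit.mk0 c h).map _))

variable {A : Type*} [CommRing A] [Algebra ℝ A] {𝔞 : Ideal A}

/-- An infinitely near point only depends on the germs of functions at its base point. -/
theorem WeilBundle.hom_congr [T2Space M] [IsManifold (𝓡∂ m) ∞ M] (hA : IsWeilAlgebra A 𝔞)
    (ξ : WeilBundle (𝓡∂ m) M 𝔞) {f g : C^∞⟮𝓡∂ m, M; ℝ⟯} (h : ∀ᶠ y in 𝓝 ξ.base, f y = g y) :
    ξ.hom f = ξ.hom g := by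
  obtain ⟨χ, hχ, h1⟩ := exists_contMDiffMap_eq_one_tsupport_subset (m := m) h
  -- The bump function is supported where `f = g`, and `ξ(χ)` is a unit because it is `1` plus a
  -- nilpotent; so `ξ(f - g)` must vanish.
  have h0 : χ * (f - g) = 0 := by
    ext y
    by_cases hy : y ∈ tsupport χ
    · simp [sub_eq_zero.2 (hχ hy)]
    · simp [image_eq_zero_of_notMem_tsupport hy]
  have hu : IsUnit (ξ.hom χ) := by
    refine hA.isUnit_of_sub_one_mem ?_
    simpa [h1.self_of_nhds] using ξ.near χ
  have h2 : ξ.hom χ * ξ.hom (f - g) = 0 := by rw [← map_mul, h0, map_zero]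
  rw [hu.mul_right_eq_zero, map_sub, sub_eq_zero] at h2
  exact h2

/-- The `i`-th coordinate function of a chart. -/
theorem contMDiffOn_chart_coord {φ : OpenPartialHomeomorph M (EuclideanHalfSpace m)}
    [IsManifold (𝓡∂ m) ∞ M]
    (hφ : φ ∈ IsManifold.maximalAtlas (𝓡∂ m) ∞ M) (i : Fin m) :
    ContMDiffOn (𝓡∂ m) 𝓘(ℝ, ℝ) ∞ (fun y => (φ y).val i) φ.source := by
  have h := OpenPartialHomeomorph.contMDiffOn_extend hφ
  exact ((EuclideanSpace.proj i : EuclideanSpace ℝ (Fin m) →L[ℝ] ℝ).contDiff.contMDiff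
    (n := ∞)).comp_contMDiffOn h

theorem exists_contMDiffMap_eventuallyEq_coord [T2Space M] [IsManifold (𝓡∂ m) ∞ M]
    {φ : OpenPartialHomeomorph M (EuclideanHalfSpace m)}
    (hφ : φ ∈ IsManifold.maximalAtlas (𝓡∂ m) ∞ M) {x : M} (hx : x ∈ φ.source) (i : Fin m) :
    ∃ f : C^∞⟮𝓡∂ m, M; ℝ⟯, ∀ᶠ y in 𝓝 x, f y = (φ y).val i :=
  (contMDiffOn_chart_coord hφ i).exists_contMDiffMap_eventuallyEq φ.open_source hx

/-- The expression of a smooth family of functions in a chart. -/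
theorem contDiffOn_comp_extend_symm [IsManifold (𝓡∂ m) ∞ M]
    {φ : OpenPartialHomeomorph M (EuclideanHalfSpace m)}
    (hφ : φ ∈ IsManifold.maximalAtlas (𝓡∂ m) ∞ M) {P : Type*} [NormedAddCommGroup P]
    [NormedSpace ℝ P] {c : P → M → ℝ}
    (hc : ContMDiff (𝓘(ℝ, P).prod (𝓡∂ m)) 𝓘(ℝ, ℝ) ∞ (uncurry c)) (s : Set P) :
    ContDiffOn ℝ ∞ (uncurry fun p => c p ∘ (φ.extend (𝓡∂ m)).symm)
      (s ×ˢ (range (𝓡∂ m) ∩ (𝓡∂ m).symm ⁻¹' φ.target)) := by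
  rw [← contMDiffOn_iff_contDiffOn, modelWithCornersSelf_prod, ← chartedSpaceSelf_prod]
  have h := contMDiffOn_extend_symm hφ
  rw [ModelWithCorners.image_eq, inter_comm] at h
  exact hc.comp_contMDiffOn (contMDiffOn_fst.prodMk
    (h.comp contMDiffOn_snd fun q hq => hq.2))

theorem ContMDiffMap.contDiffOn_comp_extend_symm [IsManifold (𝓡∂ m) ∞ M]
    {φ : OpenPartialHomeomorph M (EuclideanHalfSpace m)}
    (hφ : φ ∈ IsManifold.maximalAtlas (𝓡∂ m) ∞ M) (f : C^∞⟮𝓡∂ m, M; ℝ⟯) :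
    ContDiffOn ℝ ∞ (f ∘ (φ.extend (𝓡∂ m)).symm)
      (range (𝓡∂ m) ∩ (𝓡∂ m).symm ⁻¹' φ.target) := by
  rw [← contMDiffOn_iff_contDiffOn]
  have h := contMDiffOn_extend_symm hφ
  rw [ModelWithCorners.image_eq, inter_comm] at h
  exact f.contMDiff.comp_contMDiffOn h

/-- Hadamard's lemma gives `f = f(x) + ∑ (φ_i - x_i) g_i` near the base point. As `ξ` and `η` agree
on the coordinates, `ξ(f) - η(f) = ∑ ξ(φ_i - x_i) (ξ(g_i) - η(g_i))`, and each first factor lies in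
`𝔞`: one power is gained at each step. -/
theorem WeilBundle.hom_sub_hom_mem_pow [T2Space M] [IsManifold (𝓡∂ m) ∞ M]
    (hA : IsWeilAlgebra A 𝔞) {φ : OpenPartialHomeomorph M (EuclideanHalfSpace m)}
    (hφ : φ ∈ IsManifold.maximalAtlas (𝓡∂ m) ∞ M) {ξ η : WeilBundle (𝓡∂ m) M 𝔞}
    (hbase : η.base = ξ.base) (hξ : ξ.base ∈ φ.source)
    (h : ∀ i : Fin m, ∀ f : C^∞⟮𝓡∂ m, M; ℝ⟯, (∀ᶠ y in 𝓝 ξ.base, f y = (φ y).val i) →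
      ξ.hom f = η.hom f) (n : ℕ) (f : C^∞⟮𝓡∂ m, M; ℝ⟯) :
    ξ.hom f - η.hom f ∈ 𝔞 ^ n := by
  induction n generalizing f with
  | zero => simp
  | succ n ih =>
    set x := φ.extend (𝓡∂ m) ξ.base with hx
    have hxS : x ∈ range (𝓡∂ m) := mem_range_self _
    have hV : IsOpen ((𝓡∂ m).symm ⁻¹' φ.target) :=
      φ.open_target.preimage (𝓡∂ m).continuous_symm
    have hxV : x ∈ (𝓡∂ m).symm ⁻¹' φ.target := by
      rw [mem_preimage, hx, φ.extend_coe, comp_apply, ModelWithCorners.left_inv]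
      exact φ.map_source hξ
    -- The image of the chart need not be convex; its part in a small ball is.
    obtain ⟨r, hr, hball⟩ := Metric.isOpen_iff.1 hV x hxV
    obtain ⟨g, hg, hgx⟩ := ((𝓡∂ m).convex_range.inter (convex_ball x r)).exists_eq_add_sum_sub_mul
      ((𝓡∂ m).uniqueDiffOn.inter Metric.isOpen_ball) ⟨hxS, Metric.mem_ball_self hr⟩
      ((f.contDiffOn_comp_extend_symm hφ).mono (inter_subset_inter_right _ hball))
    set W : Set M := φ.source ∩ φ.extend (𝓡∂ m) ⁻¹' Metric.ball x r with hW
    have hWo : IsOpen W := by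
      have := (φ.continuousOn_extend (I := 𝓡∂ m)).isOpen_inter_preimage
        (φ.isOpen_extend_source (I := 𝓡∂ m)) (Metric.isOpen_ball (x := x) (ε := r))
      rwa [φ.extend_source] at this
    have hξW : ξ.base ∈ W := ⟨hξ, Metric.mem_ball_self hr⟩
    have hgM : ∀ i, ∃ G : C^∞⟮𝓡∂ m, M; ℝ⟯, ∀ᶠ y in 𝓝 ξ.base, G y = g i (φ.extend (𝓡∂ m) y) := by
      intro i
      refine ContMDiffOn.exists_contMDiffMap_eventuallyEq (U := W) ?_ hWo hξW
      refine (hg i).contMDiffOn.comp ((OpenPartialHomeomorph.contMDiffOn_extend hφ).mono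
        inter_subset_left) fun y hy => ⟨mem_range_self _, hy.2⟩
    choose G hG using hgM
    choose v hv using fun i => exists_contMDiffMap_eventuallyEq_coord hφ hξ i
    have hf : ∀ᶠ y in 𝓝 ξ.base,
        f y = (algebraMap ℝ C^∞⟮𝓡∂ m, M; ℝ⟯ (f ξ.base) +
          ∑ i, (v i - algebraMap ℝ C^∞⟮𝓡∂ m, M; ℝ⟯ (x i)) * G i) y := by
      have hv' := Filter.eventually_all.2 hv
      have hG' := Filter.eventually_all.2 hG
      filter_upwards [hv', hG', hWo.mem_nhds hξW] with y hv hG hy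
      have h1 := hgx (φ.extend (𝓡∂ m) y) ⟨mem_range_self _, hy.2⟩
      simp only [comp_apply] at h1
      rw [(φ.extend (𝓡∂ m)).left_inv (by simpa using hy.1), hx,
        (φ.extend (𝓡∂ m)).left_inv (by simpa using hξ)] at h1
      rw [h1]
      have hev : ∀ q : C^∞⟮𝓡∂ m, M; ℝ⟯,
          q y = (ContMDiffMap.evalRingHom y : C^∞⟮𝓡∂ m, M; ℝ⟯ →+* ℝ) q := fun _ => rfl
      rw [hev (_ + _), map_add, map_sum]
      refine congrArg₂ (· + ·) rfl (Finset.sum_congr rfl fun i _ => ?_)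
      rw [map_mul, map_sub]
      change _ = (v i y - x i) * G i y
      rw [hv, hG]
      rfl
    have hf' := hf
    rw [← hbase] at hf'
    rw [ξ.hom_congr hA hf, η.hom_congr hA hf', hbase]
    simp only [map_add, map_sum, map_mul, map_sub, AlgHom.commutes, add_sub_add_left_eq_sub,
      ← Finset.sum_sub_distrib, ← h _ _ (hv _), ← mul_sub]
    rw [pow_succ']
    refine Ideal.sum_mem _ fun i _ => Ideal.mul_mem_mul ?_ (ih (G i))
    have := ξ.near (v i)
    rwa [(hv i).self_of_nhds] at this

/-- An infinitely near point is determined by its base point and its values on the coordinates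
of a chart. -/
theorem WeilBundle.ext_of_coord [T2Space M] [IsManifold (𝓡∂ m) ∞ M]
    (hA : IsWeilAlgebra A 𝔞) {φ : OpenPartialHomeomorph M (EuclideanHalfSpace m)}
    (hφ : φ ∈ IsManifold.maximalAtlas (𝓡∂ m) ∞ M) {ξ η : WeilBundle (𝓡∂ m) M 𝔞}
    (hbase : η.base = ξ.base) (hξ : ξ.base ∈ φ.source)
    (h : ∀ i : Fin m, ∀ f : C^∞⟮𝓡∂ m, M; ℝ⟯, (∀ᶠ y in 𝓝 ξ.base, f y = (φ y).val i) →
      ξ.hom f = η.hom f) : ξ = η := by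
  refine WeilBundle.ext hbase.symm (AlgHom.ext fun f => ?_)
  obtain ⟨k, -, hk⟩ := hA.nilpotent
  have h1 := WeilBundle.hom_sub_hom_mem_pow hA hφ hbase hξ h (k + 1) f
  rwa [hk, Ideal.mem_bot, sub_eq_zero] at h1

end Germs

/-! ### Construction of infinitely near points by Taylor expansion -/

section Points

open Set Function

variable {m : ℕ} [NeZero m] {M : Type*} [TopologicalSpace M]
  [ChartedSpace (EuclideanHalfSpace m) M] {A : Type*} [CommRing A] [Algebra ℝ A] {𝔞 : Ideal A}

omit [ChartedSpace (EuclideanHalfSpace m) M] in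
theorem isOpen_preimage_symm_target (φ : OpenPartialHomeomorph M (EuclideanHalfSpace m)) :
    IsOpen ((𝓡∂ m).symm ⁻¹' φ.target) :=
  φ.open_target.preimage (𝓡∂ m).continuous_symm

/-- The infinitely near point to `φ⁻¹ p` with increments `N` in the coordinates of the chart `φ`:
it maps a function to the value at `N` of its Taylor expansion in these coordinates. -/
noncomputable def WeilBundle.ofChart [IsManifold (𝓡∂ m) ∞ M] [Module.Finite ℝ A]
    {φ : OpenPartialHomeomorph M (EuclideanHalfSpace m)}
    (hφ : φ ∈ IsManifold.maximalAtlas (𝓡∂ m) ∞ M) {K : ℕ} (hK : 𝔞 ^ K = ⊥) (hK0 : K ≠ 0)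
    {N : Fin m → A} (hN : ∀ i, N i ∈ 𝔞) {p : EuclideanHalfSpace m} (hp : p ∈ φ.target) :
    WeilBundle (𝓡∂ m) M 𝔞 :=
  have hpV : p.val ∈ range (𝓡∂ m) ∩ (𝓡∂ m).symm ⁻¹' φ.target :=
    ⟨mem_range_self p, by
      change (𝓡∂ m).symm ((𝓡∂ m) p) ∈ φ.target
      rwa [ModelWithCorners.left_inv]⟩
  { base := φ.symm p
    hom :=
      { toFun := fun f => taylorSum (range (𝓡∂ m)) N p.val K (f ∘ (φ.extend (𝓡∂ m)).symm)
        map_one' := (taylorSum_const hK0 1).trans (map_one _)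
        map_mul' := fun f g => taylorSum_mul hK hN (𝓡∂ m).uniqueDiffOn
          (isOpen_preimage_symm_target φ) hpV (f.contDiffOn_comp_extend_symm hφ)
          (g.contDiffOn_comp_extend_symm hφ)
        map_zero' := (taylorSum_const hK0 0).trans (map_zero _)
        map_add' := fun f g => taylorSum_add (𝓡∂ m).uniqueDiffOn
          (isOpen_preimage_symm_target φ) hpV (f.contDiffOn_comp_extend_symm hφ)
          (g.contDiffOn_comp_extend_symm hφ)
        commutes' := fun c => taylorSum_const hK0 c }
    near := fun f => by
      have h : (f ∘ (φ.extend (𝓡∂ m)).symm) p.val = f (φ.symm p) := by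
        change f (φ.symm ((𝓡∂ m).symm ((𝓡∂ m) p))) = _
        rw [ModelWithCorners.left_inv]
      rw [← h]
      exact taylorSum_sub_mem hN hK0
    smooth := fun c hc lin => by
      rw [← contDiffOn_univ]
      exact weaklySmoothOn_taylorSum (𝓡∂ m).uniqueDiffOn (isOpen_preimage_symm_target φ)
        (contDiffOn_comp_extend_symm hφ hc univ) contDiffOn_const (fun _ _ => hpV)
        (fun i => .const (N i)) K lin }

theorem WeilBundle.hom_ofChart [IsManifold (𝓡∂ m) ∞ M] [Module.Finite ℝ A]
    {φ : OpenPartialHomeomorph M (EuclideanHalfSpace m)}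
    (hφ : φ ∈ IsManifold.maximalAtlas (𝓡∂ m) ∞ M) {K : ℕ} (hK : 𝔞 ^ K = ⊥) (hK0 : K ≠ 0)
    {N : Fin m → A} (hN : ∀ i, N i ∈ 𝔞) {p : EuclideanHalfSpace m} (hp : p ∈ φ.target)
    (f : C^∞⟮𝓡∂ m, M; ℝ⟯) :
    (WeilBundle.ofChart hφ hK hK0 hN hp).hom f =
      taylorSum (range (𝓡∂ m)) N p.val K (f ∘ (φ.extend (𝓡∂ m)).symm) := rfl

theorem WeilBundle.hom_ofChart_coord [IsManifold (𝓡∂ m) ∞ M] [Module.Finite ℝ A]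
    {φ : OpenPartialHomeomorph M (EuclideanHalfSpace m)}
    (hφ : φ ∈ IsManifold.maximalAtlas (𝓡∂ m) ∞ M) {K : ℕ} (hK : 𝔞 ^ K = ⊥) (hK2 : 2 ≤ K)
    {N : Fin m → A} (hN : ∀ i, N i ∈ 𝔞) {p : EuclideanHalfSpace m} (hp : p ∈ φ.target)
    {i : Fin m} {f : C^∞⟮𝓡∂ m, M; ℝ⟯} (hf : ∀ᶠ y in 𝓝 (φ.symm p), f y = (φ y).val i) :
    (WeilBundle.ofChart hφ hK (by omega) hN hp).hom f = algebraMap ℝ A (p.val i) + N i := by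
  have hpS : p.val ∈ range (𝓡∂ m) := mem_range_self p
  rw [WeilBundle.hom_ofChart, ← taylorSum_coord (𝓡∂ m).uniqueDiffOn hpS hK2 i]
  refine taylorSum_congr hpS ?_
  have hp' : (𝓡∂ m).symm p.val = p := (𝓡∂ m).left_inv p
  have hc : Filter.Tendsto (φ.extend (𝓡∂ m)).symm (𝓝[range (𝓡∂ m)] p.val) (𝓝 (φ.symm p)) := by
    have h1 : ContinuousAt φ.symm ((𝓡∂ m).symm p.val) := by
      rw [hp']
      exact φ.continuousAt_symm hp
    have h2 : ContinuousAt (φ.symm ∘ (𝓡∂ m).symm) p.val :=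
      h1.comp (𝓡∂ m).continuous_symm.continuousAt
    have h3 := h2.tendsto.mono_left (nhdsWithin_le_nhds (s := range (𝓡∂ m)))
    rwa [comp_apply, hp'] at h3
  have hV : ∀ᶠ y in 𝓝[range (𝓡∂ m)] p.val, (𝓡∂ m).symm y ∈ φ.target :=
    nhdsWithin_le_nhds ((isOpen_preimage_symm_target φ).mem_nhds (by
      rwa [mem_preimage, hp']))
  filter_upwards [hc.eventually hf, hV, self_mem_nhdsWithin] with y hy hyV hyS
  rw [comp_apply, hy]
  change ((𝓡∂ m) (φ (φ.symm ((𝓡∂ m).symm y)))) i = y i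
  rw [φ.right_inv hyV, ModelWithCorners.right_inv _ hyS]

/-- An infinitely near point maps a function to the value of its Taylor expansion, in the
coordinates of any chart, at the increments given by its values on these coordinates. -/
theorem WeilBundle.hom_eq_taylorSum [T2Space M] [IsManifold (𝓡∂ m) ∞ M]
    (hA : IsWeilAlgebra A 𝔞) {φ : OpenPartialHomeomorph M (EuclideanHalfSpace m)}
    (hφ : φ ∈ IsManifold.maximalAtlas (𝓡∂ m) ∞ M) {K : ℕ} (hK : 𝔞 ^ K = ⊥) (hK2 : 2 ≤ K)
    {N : Fin m → A} (hN : ∀ i, N i ∈ 𝔞) {ξ : WeilBundle (𝓡∂ m) M 𝔞} (hξ : ξ.base ∈ φ.source)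
    (h : ∀ i : Fin m, ∀ f : C^∞⟮𝓡∂ m, M; ℝ⟯, (∀ᶠ y in 𝓝 ξ.base, f y = (φ y).val i) →
      ξ.hom f = algebraMap ℝ A ((φ ξ.base).val i) + N i) (f : C^∞⟮𝓡∂ m, M; ℝ⟯) :
    ξ.hom f =
      taylorSum (range (𝓡∂ m)) N (φ ξ.base).val K (f ∘ (φ.extend (𝓡∂ m)).symm) := by
  have := hA.finite
  have hb : φ.symm (φ ξ.base) = ξ.base := φ.left_inv hξ
  -- The point built from the increments of `ξ` has the same base and coordinate values as `ξ`,
  -- hence equals it.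
  have heq : ξ = WeilBundle.ofChart hφ hK (by omega) hN (φ.map_source hξ) := by
    refine WeilBundle.ext_of_coord hA hφ hb hξ fun i f hf => ?_
    rw [h i f hf, WeilBundle.hom_ofChart_coord hφ hK hK2 hN]
    rwa [hb]
  rw [← WeilBundle.hom_ofChart hφ hK (by omega) hN (φ.map_source hξ), ← heq]

end Points

/-! ### The topology of `M^A` -/

section Topology

open Set Function

variable {m : ℕ} [NeZero m] {M : Type*} [TopologicalSpace M]
  [ChartedSpace (EuclideanHalfSpace m) M] {A : Type*} [CommRing A] [Algebra ℝ A] {𝔞 : Ideal A}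
  {l : ℕ} [NeZero l] {b : Module.Basis (Fin l) ℝ A}

theorem WeilBundle.continuous_lin_hom (f : C^∞⟮𝓡∂ m, M; ℝ⟯) (lin : Module.Dual ℝ A) :
    Continuous fun ξ : WeilBundle (𝓡∂ m) M 𝔞 => lin (ξ.hom f) :=
  continuous_iInf_dom (i := f) (continuous_iInf_dom (i := lin) continuous_induced_dom)

theorem WeilBundle.continuousOn_rng {X : Type*} [TopologicalSpace X] {s : Set X}
    {g : X → WeilBundle (𝓡∂ m) M 𝔞}
    (h : ∀ (f : C^∞⟮𝓡∂ m, M; ℝ⟯) (lin : Module.Dual ℝ A),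
      ContinuousOn (fun x => lin ((g x).hom f)) s) : ContinuousOn g s := by
  rw [continuousOn_iff_continuous_domRestrict, continuous_iff_le_induced]
  simp only [WeilBundle.instTopologicalSpace, induced_iInf, induced_compose, le_iInf_iff]
  intro f lin
  rw [← continuous_iff_le_induced]
  exact (continuousOn_iff_continuous_domRestrict.1 (h f lin))

theorem IsAdaptedBasis.repr_zero (hA : IsWeilAlgebra A 𝔞) (hb : IsAdaptedBasis 𝔞 b) {a : A}
    {c : ℝ} (h : a - algebraMap ℝ A c ∈ 𝔞) : b.repr a 0 = c := by
  have h1 : a - algebraMap ℝ A (b.repr a 0) ∈ 𝔞 := by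
    have h2 := b.sum_repr a
    rw [← Finset.add_sum_erase _ _ (Finset.mem_univ 0), hb.1, ← Algebra.algebraMap_eq_smul_one,
      ← eq_sub_iff_add_eq'] at h2
    rw [← h2]
    refine Ideal.sum_mem _ fun j hj => Submodule.smul_of_tower_mem _ _ (hb.2 j ?_)
    exact (Finset.mem_erase.1 hj).1
  have h2 := 𝔞.sub_mem h h1
  rw [sub_sub_sub_cancel_left, ← map_sub] at h2
  exact sub_eq_zero.1 (hA.eq_zero_of_algebraMap_mem h2)

theorem IsAdaptedBasis.repr_hom_zero (hA : IsWeilAlgebra A 𝔞) (hb : IsAdaptedBasis 𝔞 b)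
    (ξ : WeilBundle (𝓡∂ m) M 𝔞) (f : C^∞⟮𝓡∂ m, M; ℝ⟯) : b.repr (ξ.hom f) 0 = f ξ.base :=
  hb.repr_zero hA (ξ.near f)

/-- For a bump function `χ` supported in `U`, the real part of `η(χ)` is `χ(η.base)`, which is
continuous in `η`. Where it is nonzero, the base point lies in `U`. -/
theorem WeilBundle.continuous_base [T2Space M] [IsManifold (𝓡∂ m) ∞ M]
    (hA : IsWeilAlgebra A 𝔞) (hb : IsAdaptedBasis 𝔞 b) :
    Continuous (WeilBundle.base : WeilBundle (𝓡∂ m) M 𝔞 → M) := by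
  rw [continuous_iff_continuousAt]
  intro ξ U hU
  obtain ⟨χ, hχ, h1⟩ := exists_contMDiffMap_eq_one_tsupport_subset (m := m) hU
  have hc : Continuous fun η : WeilBundle (𝓡∂ m) M 𝔞 => χ η.base := by
    have := WeilBundle.continuous_lin_hom (𝔞 := 𝔞) χ (b.coord 0)
    simpa only [Module.Basis.coord_apply, hb.repr_hom_zero hA] using this
  have hne := hc.continuousAt.eventually_ne (x := ξ) (y := 0) (by simp [h1.self_of_nhds])
  rw [Filter.mem_map]
  filter_upwards [hne] with η hη
  exact hχ (subset_tsupport _ hη)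

theorem WeilBundle.t2Space [T2Space M] [IsManifold (𝓡∂ m) ∞ M]
    (hA : IsWeilAlgebra A 𝔞) (hb : IsAdaptedBasis 𝔞 b) :
    T2Space (WeilBundle (𝓡∂ m) M 𝔞) := by
  refine ⟨fun ξ η hne => ?_⟩
  by_cases hbase : ξ.base = η.base
  · have h : ∃ f j, b.coord j (ξ.hom f) ≠ b.coord j (η.hom f) := by
      by_contra! h
      exact hne (WeilBundle.ext hbase (AlgHom.ext fun f => b.ext_elem (h f)))
    obtain ⟨f, j, hj⟩ := h
    exact separated_by_continuous (WeilBundle.continuous_lin_hom f (b.coord j)) hj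
  · exact separated_by_continuous (WeilBundle.continuous_base hA hb) hbase

end Topology

/-! ### Coordinates of infinitely near points -/

section WeilCoordinates

open Set Function

variable {m l : ℕ} [NeZero m] [NeZero l]

/-- The coordinate cutting out the half-space of `ℝ^{lm}` is thus `x_{00}`, the one lying over the
half-space coordinate of `M`. -/
theorem finProdFinEquiv_zero_zero : (finProdFinEquiv ((0 : Fin l), (0 : Fin m))) = 0 := by
  ext
  simp

/-- The point of `ℝ^m` with the coordinates `x_{i 0}`, for a point `(x_{i j})` of `ℝ^{lm}`. -/
noncomputable def weilCoordBase (v : EuclideanSpace ℝ (Fin (l * m))) : EuclideanSpace ℝ (Fin m) :=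
  WithLp.toLp 2 fun i => v (finProdFinEquiv ((0 : Fin l), i))

omit [NeZero m] in
theorem weilCoordBase_apply (v : EuclideanSpace ℝ (Fin (l * m))) (i : Fin m) :
    weilCoordBase v i = v (finProdFinEquiv ((0 : Fin l), i)) := rfl

omit [NeZero m] in
theorem contDiff_weilCoordBase :
    ContDiff ℝ ∞ (weilCoordBase : EuclideanSpace ℝ (Fin (l * m)) → _) := by
  rw [contDiff_euclidean]
  intro i
  exact (EuclideanSpace.proj (𝕜 := ℝ) (finProdFinEquiv ((0 : Fin l), i))).contDiff

theorem weilCoordBase_apply_zero (v : EuclideanSpace ℝ (Fin (l * m))) :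
    weilCoordBase v (0 : Fin m) = v 0 := by
  rw [weilCoordBase_apply, finProdFinEquiv_zero_zero]

/-- `weilCoordBase`, as a map between half-spaces. -/
noncomputable def weilHalfSpaceBase (z : EuclideanHalfSpace (l * m)) : EuclideanHalfSpace m :=
  ⟨weilCoordBase z.val, by
    rw [weilCoordBase_apply_zero]
    exact z.2⟩

theorem continuous_weilHalfSpaceBase :
    Continuous (weilHalfSpaceBase : EuclideanHalfSpace (l * m) → EuclideanHalfSpace m) :=
  (contDiff_weilCoordBase.continuous.comp continuous_subtype_val).subtype_mk _

variable {A : Type*} [CommRing A] [Algebra ℝ A] {𝔞 : Ideal A} {b : Module.Basis (Fin l) ℝ A}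

/-- The nilpotent parts of the elements of `A^m` with coordinates `x_{i j}`. -/
noncomputable def weilIncrement (b : Module.Basis (Fin l) ℝ A)
    (v : EuclideanSpace ℝ (Fin (l * m))) (i : Fin m) : A :=
  ∑ j, v (finProdFinEquiv (j, i)) • b j - algebraMap ℝ A (weilCoordBase v i)

omit [NeZero m] in
theorem IsAdaptedBasis.weilIncrement_mem (hb : IsAdaptedBasis 𝔞 b)
    (v : EuclideanSpace ℝ (Fin (l * m))) (i : Fin m) : weilIncrement b v i ∈ 𝔞 := by
  rw [weilIncrement, ← Finset.add_sum_erase _ _ (Finset.mem_univ 0), hb.1,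
    ← Algebra.algebraMap_eq_smul_one, weilCoordBase_apply, add_sub_cancel_left]
  exact Ideal.sum_mem _ fun j hj =>
    Submodule.smul_of_tower_mem _ _ (hb.2 j (Finset.mem_erase.1 hj).1)

omit [NeZero m] in
theorem weaklySmoothOn_weilIncrement (b : Module.Basis (Fin l) ℝ A) (i : Fin m)
    (s : Set (EuclideanSpace ℝ (Fin (l * m)))) :
    WeaklySmoothOn (fun v => weilIncrement b v i) s := by
  intro lin
  simp only [weilIncrement, map_sub]
  refine ContDiffOn.sub ?_ ?_
  · exact WeaklySmoothOn.sum (fun j _ => WeaklySmoothOn.smul_const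
      (EuclideanSpace.proj (𝕜 := ℝ) (finProdFinEquiv (j, i))).contDiff.contDiffOn (b j)) lin
  · exact WeaklySmoothOn.algebraMap
      ((contDiff_euclidean.1 contDiff_weilCoordBase i).contDiffOn) lin

variable {M : Type*} [TopologicalSpace M] [ChartedSpace (EuclideanHalfSpace m) M]

/-- `z = (x_{i j})` is the point of `ℝ^{lm}` determined by `ξ(φ_i) = ∑ j, x_{i j} b_j`. -/
def IsWeilCoord (φ : OpenPartialHomeomorph M (EuclideanHalfSpace m))
    (b : Module.Basis (Fin l) ℝ A) (ξ : WeilBundle (𝓡∂ m) M 𝔞)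
    (z : EuclideanHalfSpace (l * m)) : Prop :=
  ∀ i : Fin m, ∀ f : C^∞⟮𝓡∂ m, M; ℝ⟯, (∀ᶠ y in 𝓝 ξ.base, f y = (φ y).val i) →
    ξ.hom f = ∑ j : Fin l, z.val (finProdFinEquiv (j, i)) • b j

namespace IsWeilCoord

variable {φ : OpenPartialHomeomorph M (EuclideanHalfSpace m)} {ξ : WeilBundle (𝓡∂ m) M 𝔞}
  {z : EuclideanHalfSpace (l * m)}

theorem apply_eq_repr (hz : IsWeilCoord φ b ξ z) {i : Fin m} {f : C^∞⟮𝓡∂ m, M; ℝ⟯}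
    (hf : ∀ᶠ y in 𝓝 ξ.base, f y = (φ y).val i) (j : Fin l) :
    z.val (finProdFinEquiv (j, i)) = b.repr (ξ.hom f) j := by
  simp [hz i f hf, Finsupp.single_apply]

variable [T2Space M] [IsManifold (𝓡∂ m) ∞ M]

theorem unique (hφ : φ ∈ IsManifold.maximalAtlas (𝓡∂ m) ∞ M) (hξ : ξ.base ∈ φ.source)
    {z' : EuclideanHalfSpace (l * m)} (hz : IsWeilCoord φ b ξ z) (hz' : IsWeilCoord φ b ξ z') :
    z = z' := by
  refine Subtype.ext (PiLp.ext fun q => ?_)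
  obtain ⟨⟨j, i⟩, rfl⟩ := finProdFinEquiv.surjective q
  obtain ⟨f, hf⟩ := exists_contMDiffMap_eventuallyEq_coord hφ hξ i
  rw [hz.apply_eq_repr hf, hz'.apply_eq_repr hf]

theorem weilHalfSpaceBase_eq (hA : IsWeilAlgebra A 𝔞) (hb : IsAdaptedBasis 𝔞 b)
    (hφ : φ ∈ IsManifold.maximalAtlas (𝓡∂ m) ∞ M) (hξ : ξ.base ∈ φ.source)
    (hz : IsWeilCoord φ b ξ z) : weilHalfSpaceBase z = φ ξ.base := by
  refine Subtype.ext (PiLp.ext fun i => ?_)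
  obtain ⟨f, hf⟩ := exists_contMDiffMap_eventuallyEq_coord hφ hξ i
  change z.val (finProdFinEquiv (0, i)) = _
  rw [hz.apply_eq_repr hf, hb.repr_hom_zero hA, hf.self_of_nhds]

theorem hom_eq_taylorSum (hA : IsWeilAlgebra A 𝔞) (hb : IsAdaptedBasis 𝔞 b)
    (hφ : φ ∈ IsManifold.maximalAtlas (𝓡∂ m) ∞ M) (hξ : ξ.base ∈ φ.source)
    (hz : IsWeilCoord φ b ξ z) {K : ℕ} (hK : 𝔞 ^ K = ⊥) (hK2 : 2 ≤ K)
    (f : C^∞⟮𝓡∂ m, M; ℝ⟯) :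
    ξ.hom f = taylorSum (range (𝓡∂ m)) (weilIncrement b z.val) (weilCoordBase z.val) K
      (f ∘ (φ.extend (𝓡∂ m)).symm) := by
  have hbase := hz.weilHalfSpaceBase_eq hA hb hφ hξ
  have hval : weilCoordBase z.val = (φ ξ.base).val := congrArg Subtype.val hbase
  rw [hval]
  refine WeilBundle.hom_eq_taylorSum hA hφ hK hK2 (hb.weilIncrement_mem z.val) hξ
    (fun i f hf => ?_) f
  rw [hz i f hf, weilIncrement, hval, add_sub_cancel]

theorem ext_point (hA : IsWeilAlgebra A 𝔞) (hb : IsAdaptedBasis 𝔞 b)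
    (hφ : φ ∈ IsManifold.maximalAtlas (𝓡∂ m) ∞ M) (hξ : ξ.base ∈ φ.source)
    (hz : IsWeilCoord φ b ξ z) {η : WeilBundle (𝓡∂ m) M 𝔞} (hη : η.base ∈ φ.source)
    (hz' : IsWeilCoord φ b η z) : ξ = η := by
  have hbase : ξ.base = η.base := φ.injOn hξ hη
    ((hz.weilHalfSpaceBase_eq hA hb hφ hξ).symm.trans (hz'.weilHalfSpaceBase_eq hA hb hφ hη))
  refine WeilBundle.ext_of_coord hA hφ hbase.symm hξ fun i f hf => ?_
  rw [hz i f hf, hz' i f (hbase ▸ hf)]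

end IsWeilCoord

theorem exists_isWeilCoord [T2Space M] [IsManifold (𝓡∂ m) ∞ M] (hA : IsWeilAlgebra A 𝔞)
    (hb : IsAdaptedBasis 𝔞 b) {φ : OpenPartialHomeomorph M (EuclideanHalfSpace m)}
    (hφ : φ ∈ IsManifold.maximalAtlas (𝓡∂ m) ∞ M) {ξ : WeilBundle (𝓡∂ m) M 𝔞}
    (hξ : ξ.base ∈ φ.source) : ∃ z : EuclideanHalfSpace (l * m), IsWeilCoord φ b ξ z := by
  choose f hf using fun i => exists_contMDiffMap_eventuallyEq_coord hφ hξ i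
  refine ⟨⟨WithLp.toLp 2 fun q =>
    b.repr (ξ.hom (f (finProdFinEquiv.symm q).2)) (finProdFinEquiv.symm q).1, ?_⟩, ?_⟩
  -- The half-space condition holds because `x_{00}` is the value at the base point of the first
  -- coordinate of `φ`.
  · change 0 ≤ b.repr (ξ.hom (f (finProdFinEquiv.symm (0 : Fin (l * m))).2))
      (finProdFinEquiv.symm (0 : Fin (l * m))).1
    rw [← finProdFinEquiv_zero_zero, Equiv.symm_apply_apply, hb.repr_hom_zero hA,
      (hf 0).self_of_nhds]
    exact (φ ξ.base).2
  · intro i g hg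
    have h : ξ.hom g = ξ.hom (f i) := ξ.hom_congr hA (by
      filter_upwards [hg, hf i] with y h1 h2
      rw [h1, h2])
    simp only [Equiv.symm_apply_apply]
    rw [h, b.sum_repr]

theorem exists_weilBundle_isWeilCoord [T2Space M] [IsManifold (𝓡∂ m) ∞ M]
    (hA : IsWeilAlgebra A 𝔞) (hb : IsAdaptedBasis 𝔞 b)
    {φ : OpenPartialHomeomorph M (EuclideanHalfSpace m)}
    (hφ : φ ∈ IsManifold.maximalAtlas (𝓡∂ m) ∞ M) {z : EuclideanHalfSpace (l * m)}
    (hz : weilHalfSpaceBase z ∈ φ.target) :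
    ∃ ξ : WeilBundle (𝓡∂ m) M 𝔞, ξ.base ∈ φ.source ∧ IsWeilCoord φ b ξ z := by
  obtain ⟨k, hk1, hk⟩ := hA.nilpotent
  have := hA.finite
  refine ⟨WeilBundle.ofChart hφ hk (by omega) (hb.weilIncrement_mem z.val) hz,
    φ.map_target hz, fun i f hf => ?_⟩
  rw [WeilBundle.hom_ofChart_coord hφ hk (by omega) _ hz hf, weilIncrement]
  exact add_sub_cancel _ _

/-- The smooth dependence of `ξ(f)` on the coordinates of `ξ`. -/
theorem weaklySmoothOn_taylorSum_weilIncrement [IsManifold (𝓡∂ m) ∞ M] [Module.Finite ℝ A]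
    (b : Module.Basis (Fin l) ℝ A) {φ : OpenPartialHomeomorph M (EuclideanHalfSpace m)}
    (hφ : φ ∈ IsManifold.maximalAtlas (𝓡∂ m) ∞ M) (K : ℕ) (f : C^∞⟮𝓡∂ m, M; ℝ⟯) :
    WeaklySmoothOn (fun v : EuclideanSpace ℝ (Fin (l * m)) =>
        taylorSum (range (𝓡∂ m)) (weilIncrement b v) (weilCoordBase v) K
          (f ∘ (φ.extend (𝓡∂ m)).symm))
      (weilCoordBase ⁻¹' (range (𝓡∂ m) ∩ (𝓡∂ m).symm ⁻¹' φ.target)) :=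
  weaklySmoothOn_taylorSum (F := fun _ => f ∘ (φ.extend (𝓡∂ m)).symm) (𝓡∂ m).uniqueDiffOn
    (isOpen_preimage_symm_target φ)
    ((f.contDiffOn_comp_extend_symm hφ).comp contDiffOn_snd fun _ hq => hq.2)
    contDiff_weilCoordBase.contDiffOn (fun _ hv => hv)
    (fun i => weaklySmoothOn_weilIncrement b i _) K

omit [ChartedSpace (EuclideanHalfSpace m) M] in
theorem weilCoordBase_val_mem {φ : OpenPartialHomeomorph M (EuclideanHalfSpace m)}
    {z : EuclideanHalfSpace (l * m)} (hz : weilHalfSpaceBase z ∈ φ.target) :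
    weilCoordBase z.val ∈ range (𝓡∂ m) ∩ (𝓡∂ m).symm ⁻¹' φ.target :=
  ⟨mem_range_self (weilHalfSpaceBase z), by
    change (𝓡∂ m).symm ((𝓡∂ m) (weilHalfSpaceBase z)) ∈ φ.target
    rwa [ModelWithCorners.left_inv]⟩

end WeilCoordinates

/-! ### Charts of `M^A`, their transition maps and the boundary -/

section WeilChart

open Set Function

variable {m l : ℕ} [NeZero m] [NeZero l]
  {A : Type*} [CommRing A] [Algebra ℝ A] {𝔞 : Ideal A} {b : Module.Basis (Fin l) ℝ A}
  {M : Type*} [TopologicalSpace M] [ChartedSpace (EuclideanHalfSpace m) M]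

theorem isInducing_val_euclideanHalfSpace (n : ℕ) [NeZero n] :
    Topology.IsInducing (Subtype.val : EuclideanHalfSpace n → EuclideanSpace ℝ (Fin n)) :=
  ⟨rfl⟩

theorem mem_weilAtlas_iff
    {e : OpenPartialHomeomorph (WeilBundle (𝓡∂ m) M 𝔞) (EuclideanHalfSpace (l * m))} :
    e ∈ weilAtlas M 𝔞 b ↔ ∃ φ ∈ IsManifold.maximalAtlas (𝓡∂ m) ∞ M,
      e.source = {ξ | ξ.base ∈ φ.source} ∧ ∀ ξ ∈ e.source, IsWeilCoord φ b ξ (e ξ) :=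
  Iff.rfl

variable [T2Space M] [IsManifold (𝓡∂ m) ∞ M]

theorem continuousOn_of_isWeilCoord (hA : IsWeilAlgebra A 𝔞) (hb : IsAdaptedBasis 𝔞 b)
    {φ : OpenPartialHomeomorph M (EuclideanHalfSpace m)}
    (hφ : φ ∈ IsManifold.maximalAtlas (𝓡∂ m) ∞ M)
    {c : WeilBundle (𝓡∂ m) M 𝔞 → EuclideanHalfSpace (l * m)}
    (hc : ∀ ξ, ξ.base ∈ φ.source → IsWeilCoord φ b ξ (c ξ)) :
    ContinuousOn c {ξ | ξ.base ∈ φ.source} := by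
  intro ξ hξ
  have hbase := WeilBundle.continuous_base (m := m) (M := M) hA hb
  refine ContinuousAt.continuousWithinAt ?_
  rw [(isInducing_val_euclideanHalfSpace (l * m)).continuousAt_iff]
  refine (PiLp.continuous_toLp 2 _).continuousAt.comp (continuousAt_pi.2 fun q => ?_)
  obtain ⟨⟨j, i⟩, rfl⟩ := finProdFinEquiv.surjective q
  obtain ⟨f, hf⟩ := exists_contMDiffMap_eventuallyEq_coord hφ hξ i
  refine (WeilBundle.continuous_lin_hom f (b.coord j)).continuousAt.congr ?_
  have h1 := (hbase.tendsto ξ).eventually (eventually_eventually_nhds.2 hf)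
  have h2 := (hbase.tendsto ξ).eventually (φ.open_source.mem_nhds hξ)
  filter_upwards [h1, h2] with η hη hηs
  exact ((hc η hηs).apply_eq_repr hη j).symm

/-- The chart `(π⁻¹(U), (x_{i j}))` of `M^A` induced by a chart `(U, φ)` of `M`. -/
theorem exists_mem_weilAtlas (hA : IsWeilAlgebra A 𝔞) (hb : IsAdaptedBasis 𝔞 b)
    [Nonempty (WeilBundle (𝓡∂ m) M 𝔞)] {φ : OpenPartialHomeomorph M (EuclideanHalfSpace m)}
    (hφ : φ ∈ IsManifold.maximalAtlas (𝓡∂ m) ∞ M) :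
    ∃ e ∈ weilAtlas (m := m) M 𝔞 b, e.source = {ξ | ξ.base ∈ φ.source} := by
  classical
  have := hA.finite
  obtain ⟨k, hk1, hk⟩ := hA.nilpotent
  have hex : ∀ ξ : WeilBundle (𝓡∂ m) M 𝔞, ∃ z : EuclideanHalfSpace (l * m),
      ξ.base ∈ φ.source → IsWeilCoord φ b ξ z := by
    intro ξ
    by_cases hξ : ξ.base ∈ φ.source
    · obtain ⟨z, hz⟩ := exists_isWeilCoord hA hb hφ hξ
      exact ⟨z, fun _ => hz⟩
    -- An arbitrary value outside the domain of the chart.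
    · exact ⟨default, fun h => absurd h hξ⟩
  choose c hc using hex
  have hbij : BijOn c {ξ | ξ.base ∈ φ.source} (weilHalfSpaceBase ⁻¹' φ.target) := by
    refine ⟨fun ξ hξ => ?_, fun ξ hξ η hη h => ?_, fun z hz => ?_⟩
    · rw [mem_preimage, (hc ξ hξ).weilHalfSpaceBase_eq hA hb hφ hξ]
      exact φ.map_source hξ
    · exact (hc ξ hξ).ext_point hA hb hφ hξ hη (h ▸ hc η hη)
    · obtain ⟨ξ, hξ, hz'⟩ := exists_weilBundle_isWeilCoord hA hb hφ hz
      exact ⟨ξ, hξ, (hc ξ hξ).unique hφ hξ hz'⟩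
  refine ⟨
    { hbij.toPartialEquiv with
      open_source := φ.open_source.preimage (WeilBundle.continuous_base hA hb)
      open_target := φ.open_target.preimage continuous_weilHalfSpaceBase
      continuousOn_toFun := continuousOn_of_isWeilCoord hA hb hφ hc
      continuousOn_invFun := ?_ }, ⟨φ, hφ, rfl, hc⟩, rfl⟩
  -- The topology being induced by the maps `lin (ξ.hom f)`, it suffices that these be continuous in
  -- the coordinates, which the Taylor formula provides.
  refine WeilBundle.continuousOn_rng fun f lin => ?_
  have hs := (weaklySmoothOn_taylorSum_weilIncrement b hφ (k + 1) f lin).continuousOn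
  refine (hs.comp continuous_subtype_val.continuousOn fun z hz =>
    weilCoordBase_val_mem hz).congr fun z hz => ?_
  have hsrc : (hbij.toPartialEquiv.symm z).base ∈ φ.source := hbij.toPartialEquiv.map_target hz
  have hz' : IsWeilCoord φ b (hbij.toPartialEquiv.symm z) z := by
    have h := hc _ hsrc
    rwa [show c (hbij.toPartialEquiv.symm z) = z from hbij.toPartialEquiv.right_inv hz] at h
  exact congrArg lin (hz'.hom_eq_taylorSum hA hb hφ hsrc hk (by omega) f)

/-- Near a given point, the new coordinates are components of `ξ(f)` for fixed global functions `f`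
extending the germs of the `φ'_i`. The Taylor formula in the old chart makes these smooth in the old
coordinates. -/
theorem contDiffOn_weilAtlas_coordChange (hA : IsWeilAlgebra A 𝔞) (hb : IsAdaptedBasis 𝔞 b)
    {e e' : OpenPartialHomeomorph (WeilBundle (𝓡∂ m) M 𝔞) (EuclideanHalfSpace (l * m))}
    (he : e ∈ weilAtlas M 𝔞 b) (he' : e' ∈ weilAtlas M 𝔞 b) :
    ContDiffOn ℝ ∞ ((𝓡∂ (l * m)) ∘ e.symm ≫ₕ e' ∘ (𝓡∂ (l * m)).symm)
      ((𝓡∂ (l * m)).symm ⁻¹' (e.symm ≫ₕ e').source ∩ range (𝓡∂ (l * m))) := by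
  have := hA.finite
  obtain ⟨k, hk1, hk⟩ := hA.nilpotent
  obtain ⟨φ, hφ, hs, hc⟩ := mem_weilAtlas_iff.1 he
  obtain ⟨φ', hφ', hs', hc'⟩ := mem_weilAtlas_iff.1 he'
  have hbase := WeilBundle.continuous_base (m := m) (M := M) hA hb
  rintro v ⟨hv, hvr⟩
  set z := (𝓡∂ (l * m)).symm v with hz
  have hzt : z ∈ e.target := hv.1
  have hzs' : e.symm z ∈ e'.source := hv.2
  have hξ' : (e.symm z).base ∈ φ'.source := by
    rw [hs'] at hzs'
    exact hzs'
  have hcont : ContinuousAt (fun w => e.symm ((𝓡∂ (l * m)).symm w)) v :=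
    ContinuousAt.comp (f := (𝓡∂ (l * m)).symm) (e.continuousAt_symm hzt)
      (𝓡∂ (l * m)).continuous_symm.continuousAt
  rw [contDiffWithinAt_euclidean]
  intro q
  obtain ⟨⟨j, i⟩, rfl⟩ := finProdFinEquiv.surjective q
  obtain ⟨f, hf⟩ := exists_contMDiffMap_eventuallyEq_coord hφ' hξ' i
  have hmem : ∀ w ∈ (𝓡∂ (l * m)).symm ⁻¹' (e.symm ≫ₕ e').source ∩ range (𝓡∂ (l * m)),
      IsWeilCoord φ b (e.symm ((𝓡∂ (l * m)).symm w)) ((𝓡∂ (l * m)).symm w) ∧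
      (e.symm ((𝓡∂ (l * m)).symm w)).base ∈ φ.source ∧ ((𝓡∂ (l * m)).symm w).val = w := by
    rintro w ⟨hw, hwr⟩
    have hwt : (𝓡∂ (l * m)).symm w ∈ e.target := hw.1
    have h1 := hc _ (e.map_target hwt)
    rw [e.right_inv hwt] at h1
    have h2 := e.map_target hwt
    rw [hs] at h2
    exact ⟨h1, h2, (𝓡∂ (l * m)).right_inv hwr⟩
  have hsm : ContDiffWithinAt ℝ ∞ (fun w => b.coord j
      (taylorSum (range (𝓡∂ m)) (weilIncrement b w) (weilCoordBase w) (k + 1)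
        (f ∘ (φ.extend (𝓡∂ m)).symm)))
      ((𝓡∂ (l * m)).symm ⁻¹' (e.symm ≫ₕ e').source ∩ range (𝓡∂ (l * m))) v := by
    refine ((weaklySmoothOn_taylorSum_weilIncrement b hφ (k + 1) f (b.coord j)).mono
      fun w hw => ?_) v ⟨hv, hvr⟩
    obtain ⟨h1, h2, h3⟩ := hmem w hw
    have h4 := weilCoordBase_val_mem (φ := φ) (z := (𝓡∂ (l * m)).symm w) (by
      rw [h1.weilHalfSpaceBase_eq hA hb hφ h2]
      exact φ.map_source h2)
    rwa [h3] at h4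
  have hev : ∀ᶠ w in 𝓝 v, ∀ᶠ y in 𝓝 (e.symm ((𝓡∂ (l * m)).symm w)).base,
      f y = (φ' y).val i :=
    (hbase.continuousAt.comp hcont).eventually (eventually_eventually_nhds.2 hf)
  refine hsm.congr_of_eventuallyEq_of_mem ?_ ⟨hv, hvr⟩
  filter_upwards [nhdsWithin_le_nhds hev, self_mem_nhdsWithin] with w hw hws
  obtain ⟨h1, h2, h3⟩ := hmem w hws
  have h4 := (hc' _ hws.1.2).apply_eq_repr hw j
  have h5 := h1.hom_eq_taylorSum hA hb hφ h2 hk (by omega) f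
  rw [h3] at h5
  rw [← h5]
  exact h4

theorem WeilBundle.secondCountableTopology [SecondCountableTopology M]
    (hA : IsWeilAlgebra A 𝔞) (hb : IsAdaptedBasis 𝔞 b) [Nonempty (WeilBundle (𝓡∂ m) M 𝔞)] :
    SecondCountableTopology (WeilBundle (𝓡∂ m) M 𝔞) := by
  obtain ⟨s, hsc, hs⟩ := TopologicalSpace.countable_cover_nhds
    fun x : M => (chartAt (EuclideanHalfSpace m) x).open_source.mem_nhds (mem_chart_source _ x)
  choose e he hes using fun x : M => exists_mem_weilAtlas hA hb
    (IsManifold.chart_mem_maximalAtlas (I := 𝓡∂ m) (n := ∞) x)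
  have : Countable s := hsc
  have hH : SecondCountableTopology (EuclideanHalfSpace (l * m)) :=
    (isInducing_val_euclideanHalfSpace (l * m)).secondCountableTopology
  have hsec : ∀ x : s, SecondCountableTopology (e x).source :=
    fun x => (e x).secondCountableTopology_source
  refine TopologicalSpace.secondCountableTopology_of_countable_cover
    (U := fun x : s => (e x).source) (fun x => (e x).open_source) (eq_univ_of_forall fun ξ => ?_)
  have h : ξ.base ∈ ⋃ x ∈ s, (chartAt (EuclideanHalfSpace m) x).source := hs ▸ mem_univ _
  obtain ⟨x, hx, hξ⟩ := mem_iUnion₂.1 h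
  refine mem_iUnion.2 ⟨⟨x, hx⟩, ?_⟩
  rw [hes]
  exact hξ

-- Boundary points are defined through preferred charts, so their independence of the chart is
-- needed for an arbitrary `φ` of the maximal atlas.
omit [T2Space M] in
theorem chart_apply_zero_of_mem_boundary {x : M} (hx : x ∈ (𝓡∂ m).boundary M)
    {φ : OpenPartialHomeomorph M (EuclideanHalfSpace m)}
    (hφ : φ ∈ IsManifold.maximalAtlas (𝓡∂ m) ∞ M) (hxφ : x ∈ φ.source) :
    (φ x).val 0 = 0 := by
  by_contra hne
  have hpos : 0 < (φ x).val 0 := lt_of_le_of_ne (φ x).2 (Ne.symm hne)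
  have hint : (𝓡∂ m) (φ x) ∈ interior (range (𝓡∂ m)) := by
    change (φ x).val ∈ interior (range (Subtype.val : EuclideanHalfSpace m → _))
    rw [range_euclideanHalfSpace, interior_halfSpace]
    exact hpos
  have hcompat : ∀ e e' : OpenPartialHomeomorph M (EuclideanHalfSpace m),
      e ∈ IsManifold.maximalAtlas (𝓡∂ m) ∞ M → e' ∈ IsManifold.maximalAtlas (𝓡∂ m) ∞ M →
        e.symm ≫ₕ e' ∈ contDiffGroupoid ∞ (𝓡∂ m) := fun e e' he he' =>
    StructureGroupoid.compatible_of_mem_maximalAtlas he he'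
  -- The atlas is enlarged to the maximal one with unchanged preferred charts: interior points stay
  -- the same, while `φ` becomes a member of the atlas, to which chart invariance applies.
  let cs : ChartedSpace (EuclideanHalfSpace m) M :=
    { atlas := IsManifold.maximalAtlas (𝓡∂ m) ∞ M
      chartAt := chartAt (EuclideanHalfSpace m)
      mem_chart_source := mem_chart_source (EuclideanHalfSpace m)
      chart_mem_atlas := IsManifold.chart_mem_maximalAtlas }
  have hcs : @IsManifold ℝ _ _ _ _ _ _ (𝓡∂ m) ∞ M _ cs :=
    letI := cs
    { compatible := fun he he' => hcompat _ _ he he' }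
  have h := (@ModelWithCorners.isInteriorPoint_iff_of_mem_atlas ℝ _ _ _ _ _ _ (𝓡∂ m) M _ cs
    ∞ hcs φ x (by simp) hφ hxφ).2 (φ.mem_interior_extend_target (φ.map_source hxφ) hint)
  exact ((𝓡∂ m).isInteriorPoint_iff_not_isBoundaryPoint x).1 h hx

end WeilChart

/-! ### Nonempty fibres and the theorem -/

theorem WeilBundle.fibre_nonempty {m : ℕ} [NeZero m] {M : Type*} [TopologicalSpace M]
    [ChartedSpace (EuclideanHalfSpace m) M] [IsManifold (𝓡∂ m) ∞ M]
    {A : Type*} [CommRing A] [Algebra ℝ A] {𝔞 : Ideal A} (hA : IsWeilAlgebra A 𝔞) (x : M) :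
    (WeilBundle.fibre (𝓡∂ m) 𝔞 x).Nonempty := by
  have := hA.finite
  obtain ⟨k, -, hk⟩ := hA.nilpotent
  -- Zero increments give the point `f ↦ f(x) · 1`.
  exact ⟨WeilBundle.ofChart (IsManifold.chart_mem_maximalAtlas (I := 𝓡∂ m) (n := ∞) x) hk
      k.succ_ne_zero (N := 0) (fun _ => 𝔞.zero_mem) (mem_chart_target _ x),
    (chartAt (EuclideanHalfSpace m) x).left_inv (mem_chart_source _ x)⟩

theorem proposition2p2 {m : ℕ} [NeZero m] (M : Type*) [TopologicalSpace M] [T2Space M]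
    [SecondCountableTopology M] [ChartedSpace (EuclideanHalfSpace m) M] [IsManifold (𝓡∂ m) ∞ M]
    (hM : ((𝓡∂ m).boundary M).Nonempty)
    {A : Type*} [CommRing A] [Algebra ℝ A] {𝔞 : Ideal A} (hA : IsWeilAlgebra A 𝔞)
    {l : ℕ} [NeZero l] (b : Module.Basis (Fin l) ℝ A) (hb : IsAdaptedBasis 𝔞 b) :
    -- `M^A`, with its canonical topology and atlas, is a smooth real manifold with boundary
    T2Space (WeilBundle (𝓡∂ m) M 𝔞) ∧
    SecondCountableTopology (WeilBundle (𝓡∂ m) M 𝔞) ∧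
    (∃ cs : ChartedSpace (EuclideanHalfSpace (l * m)) (WeilBundle (𝓡∂ m) M 𝔞),
      cs.atlas = weilAtlas M 𝔞 b) ∧
    ∀ cs : ChartedSpace (EuclideanHalfSpace (l * m)) (WeilBundle (𝓡∂ m) M 𝔞),
      cs.atlas = weilAtlas M 𝔞 b →
        IsManifold (𝓡∂ (l * m)) ∞ (WeilBundle (𝓡∂ m) M 𝔞) ∧
        -- its boundary is nonempty and contains the fibres over the boundary of `M`
        ((𝓡∂ (l * m)).boundary (WeilBundle (𝓡∂ m) M 𝔞)).Nonempty ∧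
        (⋃ x ∈ (𝓡∂ m).boundary M, WeilBundle.fibre (𝓡∂ m) 𝔞 x) ⊆
          (𝓡∂ (l * m)).boundary (WeilBundle (𝓡∂ m) M 𝔞) := by
  obtain ⟨x₀, hx₀⟩ := hM
  obtain ⟨ξ₀, hξ₀⟩ := WeilBundle.fibre_nonempty (m := m) hA x₀
  have : Nonempty (WeilBundle (𝓡∂ m) M 𝔞) := ⟨ξ₀⟩
  refine ⟨WeilBundle.t2Space (m := m) hA hb, WeilBundle.secondCountableTopology hA hb, ?_, ?_⟩
  · choose e he hes using fun x : M => exists_mem_weilAtlas hA hb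
      (IsManifold.chart_mem_maximalAtlas (I := 𝓡∂ m) (n := ∞) x)
    exact ⟨{ atlas := weilAtlas M 𝔞 b
             chartAt := fun ξ => e ξ.base
             mem_chart_source := fun ξ => by
               rw [hes]
               exact mem_chart_source _ ξ.base
             chart_mem_atlas := fun ξ => he ξ.base }, rfl⟩
  · intro cs hcs
    have hsub : (⋃ x ∈ (𝓡∂ m).boundary M, WeilBundle.fibre (𝓡∂ m) 𝔞 x) ⊆
        (𝓡∂ (l * m)).boundary (WeilBundle (𝓡∂ m) M 𝔞) := by
      refine Set.iUnion₂_subset fun x hx ξ hξ => ?_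
      obtain rfl : ξ.base = x := hξ
      -- Only the atlas of `cs` is prescribed; its preferred chart at `ξ` comes from some chart `φ`
      -- of `M`, not necessarily a preferred one.
      have hmem : chartAt (EuclideanHalfSpace (l * m)) ξ ∈ weilAtlas M 𝔞 b :=
        hcs ▸ chart_mem_atlas _ ξ
      obtain ⟨φ, hφ, hs, hc⟩ := mem_weilAtlas_iff.1 hmem
      have hξs := mem_chart_source (EuclideanHalfSpace (l * m)) ξ
      have hbase : ξ.base ∈ φ.source := by
        have h := hξs
        rw [hs] at h
        exact h
      have h0 := chart_apply_zero_of_mem_boundary hx hφ hbase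
      rw [← (hc ξ hξs).weilHalfSpaceBase_eq hA hb hφ hbase] at h0
      rw [ModelWithCorners.boundary, Set.mem_ofPred_eq, ModelWithCorners.isBoundaryPoint_iff]
      change (chartAt (EuclideanHalfSpace (l * m)) ξ ξ).val ∈
        frontier (Set.range (Subtype.val : EuclideanHalfSpace (l * m) → _))
      rw [range_euclideanHalfSpace, frontier_halfSpace]
      exact h0.symm.trans (weilCoordBase_apply_zero _)
    refine ⟨isManifold_of_contDiffOn _ _ _ fun e e' he he' => ?_, ?_, hsub⟩
    · exact contDiffOn_weilAtlas_coordChange hA hb (hcs ▸ he) (hcs ▸ he')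
    · exact ⟨ξ₀, hsub (Set.mem_iUnion₂.2 ⟨x₀, hx₀, hξ₀⟩)⟩
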